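/- **Setting.** Let $\mathrm{conv}(\mathbb R^n)$ be the space of nonempty convex compact subsets of $\mathbb R^n$ with the Hausdorff metric, Minkowski addition and multiplication by nonnegative scalars. Identify $u\in\mathrm{conv}(\mathbb R^n)$ with its support function $h_u(p)=\sup_{x\in u}(x,p)$ and put $\|u\|=\|h_u\|_{C(S^{n-1})}=\sup_{|p|=1}|h_u(p)|$. Let $V[u]$ be the volume of $u$ and $V_1[u,w]=V[u,\dots,u,w]$ the first mixed volume, so that $nV_1[u,w]=\lim_{\rho\to0+}\rho^{-1}(V[u+\rho w]-V[u])$. Let $A$ be a linear operator on $\mathbb R^n$, let $\varphi:\mathbb R_+\to\mathbb R_+$ and $F:\mathbb R_+\times\mathrm{conv}(\mathbb R^n)\to\mathrm{conv}(\mathbb R^n)$ be locally Lipschitz, where $\mathbb R_+=[0,\infty)$, and let $(\exp\{\mathcal At\}h)(p)=h(e^{A^Tt}p)$. Consider the integral equation $$u(t)=\exp\Big\{\mathcal A\int_0^t\varphi(V[u(s)])\,ds\Big\}u_0+\int_0^t\exp\Big\{\mathcal A\int_s^t\varphi(V[u(\tau)])\,d\tau\Big\}F(V[u(s)],u(s))\,ds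 .$$ Let $G\subset\mathrm{conv}(\mathbb R^n)$ be closed with $\{0\}\in G$, and suppose that this equation generates a global semiflow $\mathfrak F$ on $G$: for every $u_0\in G$ the curve $t\mapsto\mathfrak F^t(u_0)\in G$ is a continuous solution on $[0,\infty)$. Suppose that $\mathfrak F^t(\{0\})=\{0\}$ for all $t\ge0$. **Assumptions.** Let $r>0$ and $B_r(0)=\{u\in G:\|u\|\le r\}$. Assume the following for all $u_0\in B_r(0)$. 1. $N>0$ and $\alpha\in\mathbb R$ are constants with $\|e^{At}\|\le Ne^{\alpha t}$ for $t\ge0$. 2. $g_*,g^*:\mathbb R_+\to\mathbb R_+$ are locally Lipschitz and $g_*(V[u])\le nV_1[u,F(V[u],u)]\le g^*(V[u])$ for all $u\in\mathrm{conv}(\mathbb R^n)$. 3. The maximal solution $\zeta^+$ of $\zeta'=\operatorname{tr}A\,\varphi(\zeta)\zeta+g^*(\zeta)$, $\zeta(0)=V[u_0]$, and the minimal solution $\chi_-$ of $\chi'=\operatorname{tr}A\,\varphi(\chi)\chi+g_*(\chi)$, $\chi(0)=V[u_0]$, exist on $[0,\infty)$. 4. $(t,\omega)\mapsto F^+(t,\omega,V[u_0])\in\mathbb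 R_+$ is continuous on $\mathbb R_+\times\mathbb R_+$, nondecreasing in $\omega$, and $$\sup_{\chi_-(t)\le s\le\zeta^+(t)}\|F(s,u)\|\le F^+(t,\|u\|,V[u_0])\qquad\text{for all }(t,u)\in\mathbb R_+\times\mathrm{conv}(\mathbb R^n).$$ Let $\Lambda^+(t,V[u_0])$ and $\Lambda^-(t,V[u_0])$ be the maximum and the minimum of $\varphi$ over $[\chi_-(t),\zeta^+(t)]$, and assume that for all $t,\omega\ge0$ the following exist (are finite): $$\hat\Lambda^+(t)=\sup_{u_0\in B_r(0)}\Lambda^+(t,V[u_0]),\qquad \hat\Lambda^-(t)=\inf_{u_0\in B_r(0)}\Lambda^-(t,V[u_0]),\qquad \hat F^+(t,\omega)=\sup_{u_0\in B_r(0)}F^+(t,\omega,V[u_0]).$$ Consider the scalar comparison equation for $\omega\ge0$ $$\frac{d\omega}{dt}=\alpha\hat\Lambda^{\pm}(t)\,\omega+\hat F^+(t,N\omega),$$ with $\hat\Lambda^+$ if $\alpha>0$ and $\hat\Lambda^-$ if $\alpha\le0$. Its solutions are understood in the integrated (Carathéodory) sense, which is the classical one when the right side is continuous. Its solution $\omega=0$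 is called *stable* if for every $\varepsilon>0$ there is $\delta>0$ such that for every $\omega(0)\in[0,\delta)$ a solution exists on $[0,\infty)$ and every solution satisfies $\omega(t)<\varepsilon$ on its whole interval of existence $[0,T)$. It is called *asymptotically stable* if it is stable and there is $\rho>0$ such that every solution on $[0,\infty)$ with $\omega(0)\in[0,\rho)$ tends to $0$ as $t\to+\infty$. **Theorem 4.6.** 1. If the solution $\omega=0$ of the comparison equation is stable, then $\mathfrak F$ is stable with respect to $\|\cdot\|$: for every $\varepsilon>0$ there is $\delta>0$ such that $u_0\in G$ and $\|u_0\|<\delta$ imply $\|\mathfrak F^t(u_0)\|<\varepsilon$ for all $t\ge0$. 2. If the solution $\omega=0$ of the comparison equation is asymptotically stable, then $\mathfrak F$ is asymptotically stable with respect to $\|\cdot\|$: it is stable, and there is $\rho>0$ such that $u_0\in G$ and $\|u_0\|<\rho$ imply $\|\mathfrak F^t(u_0)\|\to0$ as $t\to+\infty$. -/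

import Mathlib

open Set Filter Topology MeasureTheory

noncomputable section

namespace ConvSemiflow

/-- The space `ℝⁿ` with its Euclidean norm. -/
abbrev E (n : ℕ) : Type := EuclideanSpace ℝ (Fin n)

/-- The metric space `conv(ℝⁿ)` of nonempty convex compact subsets of `ℝⁿ`. Mathlib equips it with
the Hausdorff metric, Minkowski addition and multiplication by scalars; its `0` is `{0}`. -/
abbrev Conv (n : ℕ) : Type := ConvexBody (E n)

variable {n : ℕ}

/-- The support function `h_u(p) = sup_{x ∈ u} (x, p)`. -/
def supportFun (u : Conv n) (p : E n) : ℝ :=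
  sSup ((fun x : E n => inner ℝ x p) '' (u : Set (E n)))

/-- The norm `‖u‖_{C(S^{n-1})}`: the sup norm of the support function over the unit sphere. -/
def supNorm (u : Conv n) : ℝ :=
  ⨆ p : Metric.sphere (0 : E n) 1, |supportFun u p|

/-- The volume `V[u]`. -/
def vol (u : Conv n) : ℝ :=
  (volume (u : Set (E n))).toReal

/-- The first mixed volume `V₁[u, w] = V[u, …, u, w]`, given by Minkowski's formula
`n V₁[u, w] = lim_{ρ → 0+} (V[u + ρ w] - V[u]) / ρ`. (The limit exists for all convex compact
`u, w`, since `V[u + ρ w]` is a polynomial in `ρ ≥ 0`.) -/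
def mixedVol₁ (u w : Conv n) : ℝ :=
  (1 / (n : ℝ)) * derivWithin (fun ρ : ℝ => vol (u + ρ • w)) (Ici 0) 0

/-- The parameters of the integral equation: a linear operator `A` on `ℝⁿ` and locally Lipschitz
maps `φ : ℝ₊ → ℝ₊` and `F : ℝ₊ × conv(ℝⁿ) → conv(ℝⁿ)`. The functions are total in Lean; only their
values on `ℝ₊ = [0, ∞)` are ever used. -/
structure Params (n : ℕ) where
  A : E n →L[ℝ] E n
  φ : ℝ → ℝ
  F : ℝ → Conv n → Conv n
  φ_nonneg : ∀ s, 0 ≤ s → 0 ≤ φ s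
  φ_lipschitz : LocallyLipschitzOn (Ici 0) φ
  F_lipschitz : LocallyLipschitzOn (Ici (0 : ℝ) ×ˢ (univ : Set (Conv n)))
    (fun q : ℝ × Conv n => F q.1 q.2)

/-- The trace of `A`. -/
def Params.tr (P : Params n) : ℝ :=
  LinearMap.trace ℝ (E n) (P.A : E n →ₗ[ℝ] E n)

/-- The operator `exp{𝒜 t}` on functions of `p`: `(exp{𝒜 t} f)(p) = f(e^{Aᵀ t} p)`. On the support
function of `u` it gives the support function of the set `e^{At} u`. -/
def Params.expOp (P : Params n) (t : ℝ) (f : E n → ℝ) (p : E n) : ℝ :=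
  f (NormedSpace.exp (t • ContinuousLinearMap.adjoint P.A) p)

/-- `u : [0, ∞) → conv(ℝⁿ)` is a (continuous) solution of the integral equation
`u(t) = exp{𝒜 ∫₀ᵗ φ(V[u(s)]) ds} u₀ + ∫₀ᵗ exp{𝒜 ∫ₛᵗ φ(V[u(τ)]) dτ} F(V[u(s)], u(s)) ds`,
where convex compact sets are identified with their support functions. -/
def Params.IsSolution (P : Params n) (u₀ : Conv n) (u : ℝ → Conv n) : Prop :=
  ContinuousOn u (Ici 0) ∧
  ∀ t, 0 ≤ t → ∀ p : E n,
    supportFun (u t) p =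
      P.expOp (∫ s in (0 : ℝ)..t, P.φ (vol (u s))) (supportFun u₀) p +
      ∫ s in (0 : ℝ)..t,
        P.expOp (∫ τ in s..t, P.φ (vol (u τ))) (supportFun (P.F (vol (u s)) (u s))) p

/-- `𝔉` is the global semiflow generated by the integral equation on the set `G`: for `u₀ ∈ G` the
orbit `t ↦ 𝔉ᵗ(u₀)` solves the integral equation on the whole of `[0, ∞)` and stays in `G`. -/
def Params.IsGlobalSemiflowOn (P : Params n) (G : Set (Conv n)) (𝔉 : ℝ → Conv n → Conv n) : Prop :=
  ∀ u₀ ∈ G, (∀ t, 0 ≤ t → 𝔉 t u₀ ∈ G) ∧ P.IsSolution u₀ (fun t => 𝔉 t u₀)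

/-- `(h₀, h)`-stability of a global semiflow on `G`. -/
def SemiflowStable (G : Set (Conv n)) (𝔉 : ℝ → Conv n → Conv n) (h₀ h : Conv n → ℝ) : Prop :=
  ∀ ε > 0, ∃ δ > 0, ∀ u₀ ∈ G, h₀ u₀ < δ → ∀ t, 0 ≤ t → h (𝔉 t u₀) < ε

/-- Asymptotic `(h₀, h)`-stability of a global semiflow on `G`. -/
def SemiflowAsympStable (G : Set (Conv n)) (𝔉 : ℝ → Conv n → Conv n) (h₀ h : Conv n → ℝ) : Prop :=
  SemiflowStable G 𝔉 h₀ h ∧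
  ∃ ρ > 0, ∀ u₀ ∈ G, h₀ u₀ < ρ → Tendsto (fun t => h (𝔉 t u₀)) atTop (𝓝 0)

/-- `z : I → ℝ₊` is a classical solution of `z' = f(z)`, `z(0) = z₀`, on the interval `I ∋ 0`. -/
def IsAutonomousSolution (f : ℝ → ℝ) (I : Set ℝ) (z₀ : ℝ) (z : ℝ → ℝ) : Prop :=
  z 0 = z₀ ∧ ∀ t ∈ I, 0 ≤ z t ∧ HasDerivWithinAt z (f (z t)) I t

/-- The maximal solution of `z' = f(z)`, `z(0) = z₀` in `ℝ₊` is defined on `[0, ∞)` and equals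
`z`. -/
def IsMaximalSolution (f : ℝ → ℝ) (z₀ : ℝ) (z : ℝ → ℝ) : Prop :=
  IsAutonomousSolution f (Ici 0) z₀ z ∧
  ∀ T > 0, ∀ y, IsAutonomousSolution f (Ico 0 T) z₀ y → ∀ t ∈ Ico 0 T, y t ≤ z t

/-- The minimal solution of `z' = f(z)`, `z(0) = z₀` in `ℝ₊` is defined on `[0, ∞)` and equals
`z`. -/
def IsMinimalSolution (f : ℝ → ℝ) (z₀ : ℝ) (z : ℝ → ℝ) : Prop :=
  IsAutonomousSolution f (Ici 0) z₀ z ∧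
  ∀ T > 0, ∀ y, IsAutonomousSolution f (Ico 0 T) z₀ y → ∀ t ∈ Ico 0 T, z t ≤ y t

/-- The closed ball `B_r(0)` of the phase space `G`. -/
def ball (G : Set (Conv n)) (r : ℝ) : Set (Conv n) :=
  {u | u ∈ G ∧ supNorm u ≤ r}

/-- The comparison conditions, for all initial sets `u₀` in `B`. Here `χ v` and `ζ v` are the
solutions `χ₋` and `ζ⁺` with initial value `v`, and `Fp t ω v` is `F⁺(t, ω, v)`. -/
structure ComparisonConditions (P : Params n) (B : Set (Conv n)) (N α : ℝ) (gLow gUp : ℝ → ℝ)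
    (χ ζ : ℝ → ℝ → ℝ) (Fp : ℝ → ℝ → ℝ → ℝ) : Prop where
  N_pos : 0 < N
  exp_bound : ∀ t : ℝ, 0 ≤ t → ‖NormedSpace.exp (t • P.A)‖ ≤ N * Real.exp (α * t)
  gLow_nonneg : ∀ s, 0 ≤ s → 0 ≤ gLow s
  gLow_lipschitz : LocallyLipschitzOn (Ici 0) gLow
  gUp_nonneg : ∀ s, 0 ≤ s → 0 ≤ gUp s
  gUp_lipschitz : LocallyLipschitzOn (Ici 0) gUp
  gLow_le : ∀ u : Conv n, gLow (vol u) ≤ (n : ℝ) * mixedVol₁ u (P.F (vol u) u)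
  le_gUp : ∀ u : Conv n, (n : ℝ) * mixedVol₁ u (P.F (vol u) u) ≤ gUp (vol u)
  zeta_maximal : ∀ u₀ ∈ B,
    IsMaximalSolution (fun z => P.tr * P.φ z * z + gUp z) (vol u₀) (ζ (vol u₀))
  chi_minimal : ∀ u₀ ∈ B,
    IsMinimalSolution (fun z => P.tr * P.φ z * z + gLow z) (vol u₀) (χ (vol u₀))
  Fp_nonneg : ∀ u₀ ∈ B, ∀ t ω, 0 ≤ t → 0 ≤ ω → 0 ≤ Fp t ω (vol u₀)
  Fp_continuous : ∀ u₀ ∈ B,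
    ContinuousOn (fun q : ℝ × ℝ => Fp q.1 q.2 (vol u₀)) (Ici 0 ×ˢ Ici 0)
  Fp_monotone : ∀ u₀ ∈ B, ∀ t, 0 ≤ t → MonotoneOn (fun ω => Fp t ω (vol u₀)) (Ici 0)
  F_bound : ∀ u₀ ∈ B, ∀ t, 0 ≤ t → ∀ u : Conv n,
    ∀ s ∈ Icc (χ (vol u₀) t) (ζ (vol u₀) t), supNorm (P.F s u) ≤ Fp t (supNorm u) (vol u₀)

/-- `Λ⁺(t, v)`, the maximum of `φ` over `[χ₋(t), ζ⁺(t)]`. -/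
def lambdaPlus (φ : ℝ → ℝ) (χ ζ : ℝ → ℝ → ℝ) (t v : ℝ) : ℝ :=
  sSup (φ '' Icc (χ v t) (ζ v t))

/-- `Λ⁻(t, v)`, the minimum of `φ` over `[χ₋(t), ζ⁺(t)]`. -/
def lambdaMinus (φ : ℝ → ℝ) (χ ζ : ℝ → ℝ → ℝ) (t v : ℝ) : ℝ :=
  sInf (φ '' Icc (χ v t) (ζ v t))

/-- The right side `α Λ̂^±(t) ω + F̂⁺(t, N ω)` of the scalar comparison equation, with `Λ̂⁺` for
`α > 0` and `Λ̂⁻` for `α ≤ 0`. -/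
def comparisonRhs (N α : ℝ) (Lp Lm : ℝ → ℝ) (Fh : ℝ → ℝ → ℝ) (t ω : ℝ) : ℝ :=
  α * (if 0 < α then Lp t else Lm t) * ω + Fh t (N * ω)

/-- `ω : I → ℝ₊` is a solution of `ω' = f(t, ω)`, `ω(0) = ω₀`, on the interval `I ∋ 0` (`[0, T)` or
`[0, ∞)`), in the integrated (Caratheodory) sense: for a continuous `f` these are precisely the
classical solutions. -/
def IsScalarSolution (f : ℝ → ℝ → ℝ) (I : Set ℝ) (ω₀ : ℝ) (ω : ℝ → ℝ) : Prop :=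
  ContinuousOn ω I ∧
  ∀ t ∈ I, 0 ≤ ω t ∧ IntervalIntegrable (fun s => f s (ω s)) volume 0 t ∧
    ω t = ω₀ + ∫ s in (0 : ℝ)..t, f s (ω s)

/-- The zero solution of `ω' = f(t, ω)` in `ℝ₊` is Lyapunov stable: solutions that start close to
`0` exist on `[0, ∞)` and all of them stay close to `0`. No uniqueness is required; for a continuous
`f` the existence clause is automatic. -/
def ZeroStable (f : ℝ → ℝ → ℝ) : Prop :=
  IsScalarSolution f (Ici 0) 0 (fun _ => 0) ∧
  ∀ ε > 0, ∃ δ > 0, ∀ ω₀, 0 ≤ ω₀ → ω₀ < δ →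
    (∃ ω, IsScalarSolution f (Ici 0) ω₀ ω) ∧
    ∀ T > 0, ∀ ω, IsScalarSolution f (Ico 0 T) ω₀ ω → ∀ t ∈ Ico 0 T, ω t < ε

/-- The zero solution of `ω' = f(t, ω)` in `ℝ₊` is asymptotically Lyapunov stable. -/
def ZeroAsympStable (f : ℝ → ℝ → ℝ) : Prop :=
  ZeroStable f ∧
  ∃ ρ > 0, ∀ ω₀, 0 ≤ ω₀ → ω₀ < ρ →
    ∀ ω, IsScalarSolution f (Ici 0) ω₀ ω → Tendsto ω atTop (𝓝 0)

end ConvSemiflow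

end

/-! Along an orbit put `a(s) = φ(V[u(s)])` and `b(s) = F(V[u(s)], u(s))`, so that the equation
becomes linear with known continuous coefficients. Two scalar comparisons then settle the theorem.

Volume. The orbit satisfies, with a right derivative, `V' = tr A · a · V + n V₁[u, b]`. By the
bounds on the mixed volume, `V[u(t)]` is a subsolution of the equation of `ζ⁺` and a supersolution
of that of `χ₋`. These equations are locally Lipschitz, so `V[u(t)]` stays in `[χ₋(t), ζ⁺(t)]`
(`vol_mem_Icc`).

Norm. Taking norms in the integral equation gives `‖u(t)‖ ≤ N w(t)`, where `w' = α a w + ‖b‖` and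
`w(0) = ‖u₀‖`. By the enclosure of the volume and the monotonicity of `F⁺`, the right side for `w`
is dominated by that of the comparison equation as long as `w ≤ ω`. Hence every solution `ω` with
`ω(0) > ‖u₀‖` stays above `w`, and `‖u(t)‖ < N ω(t)` (`supNorm_lt_of_isScalarSolution`). The strict
initial gap makes uniqueness and continuity of the comparison equation superfluous, and it is free:
if `‖u₀‖ < δ`, some `ω(0)` lies strictly between.

The hard part is the volume equation. Over a short time `u(t')` equals `e^{τA}(u(t) + (t' - t)
b(t))`, with `τ` the integral of `a` over `[t, t']`, up to an error `o(t' - t)` in the support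
function. Two geometric facts turn this into a derivative: the volume is Lipschitz in the support
function on bounded sets (`exists_abs_vol_sub_le`), and `ρ ↦ V[u + ρ w]` has a right derivative at
`0` (`differentiableWithinAt_vol_add`). The second gives `mixedVol₁` its meaning. For a body in a
hyperplane it follows from a rescaling in the normal direction, for a body with interior from
concavity of the radial function of `u + s w` in `s`. The determinant contributes the trace term. -/

noncomputable section

namespace ConvSemiflow

variable {n : ℕ}

open scoped Pointwise

/-! ### Support functions, the sup norm and the Hausdorff metric -/

section Support

theorem bddAbove_inner (u : Conv n) (p : E n) :
    BddAbove ((fun x : E n => inner ℝ x p) '' (u : Set (E n))) :=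
  (u.isCompact.image (by fun_prop)).bddAbove

theorem inner_le_supportFun {u : Conv n} {x : E n} (hx : x ∈ u) (p : E n) :
    inner ℝ x p ≤ supportFun u p :=
  le_csSup (bddAbove_inner u p) ⟨x, hx, rfl⟩

theorem supportFun_le {u : Conv n} {p : E n} {c : ℝ} (h : ∀ x ∈ u, inner ℝ x p ≤ c) :
    supportFun u p ≤ c :=
  csSup_le (u.nonempty.image _) (by rintro _ ⟨x, hx, rfl⟩; exact h x hx)

theorem exists_inner_eq_supportFun (u : Conv n) (p : E n) :
    ∃ x ∈ u, inner ℝ x p = supportFun u p := by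
  have := (u.isCompact.image (f := fun x : E n => inner ℝ x p) (by fun_prop)).sSup_mem
    (u.nonempty.image _)
  obtain ⟨x, hx, h⟩ := this
  exact ⟨x, hx, h⟩

theorem mem_add_iff {u w : Conv n} {x : E n} : x ∈ u + w ↔ ∃ a ∈ u, ∃ b ∈ w, a + b = x := by
  rw [← SetLike.mem_coe, ConvexBody.coe_add, Set.mem_add]; rfl

theorem mem_smul_iff {c : ℝ} {u : Conv n} {x : E n} : x ∈ c • u ↔ ∃ a ∈ u, c • a = x := by
  rw [← SetLike.mem_coe, ConvexBody.coe_smul, Set.mem_smul_set]; rfl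

theorem supportFun_add (u w : Conv n) (p : E n) :
    supportFun (u + w) p = supportFun u p + supportFun w p := by
  apply le_antisymm
  · refine supportFun_le fun x hx => ?_
    obtain ⟨a, ha, b, hb, rfl⟩ := mem_add_iff.1 hx
    rw [inner_add_left]
    exact add_le_add (inner_le_supportFun ha p) (inner_le_supportFun hb p)
  · obtain ⟨a, ha, h₁⟩ := exists_inner_eq_supportFun u p
    obtain ⟨b, hb, h₂⟩ := exists_inner_eq_supportFun w p
    rw [← h₁, ← h₂, ← inner_add_left]
    exact inner_le_supportFun (mem_add_iff.2 ⟨a, ha, b, hb, rfl⟩) p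

theorem supportFun_smul {c : ℝ} (hc : 0 ≤ c) (u : Conv n) (p : E n) :
    supportFun (c • u) p = c * supportFun u p := by
  apply le_antisymm
  · refine supportFun_le fun x hx => ?_
    obtain ⟨a, ha, rfl⟩ := mem_smul_iff.1 hx
    rw [real_inner_smul_left]
    exact mul_le_mul_of_nonneg_left (inner_le_supportFun ha p) hc
  · obtain ⟨a, ha, h₁⟩ := exists_inner_eq_supportFun u p
    rw [← h₁, ← real_inner_smul_left]
    exact inner_le_supportFun (mem_smul_iff.2 ⟨a, ha, rfl⟩) p

theorem supportFun_smul_right {c : ℝ} (hc : 0 ≤ c) (u : Conv n) (p : E n) :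
    supportFun u (c • p) = c * supportFun u p := by
  rw [← supportFun_smul hc]
  apply le_antisymm
  · refine supportFun_le fun x hx => ?_
    rw [real_inner_smul_right, ← real_inner_smul_left]
    exact inner_le_supportFun (mem_smul_iff.2 ⟨x, hx, rfl⟩) p
  · refine supportFun_le fun x hx => ?_
    obtain ⟨a, ha, rfl⟩ := mem_smul_iff.1 hx
    rw [real_inner_smul_left, ← real_inner_smul_right]
    exact inner_le_supportFun ha _

/-- A point of `u` outside the closed convex set `w` would be strictly separated from `w` by a
functional, whose Riesz vector violates the inequality. -/
theorem subset_of_supportFun_le {u w : Conv n} (h : ∀ p, supportFun u p ≤ supportFun w p) :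
    (u : Set (E n)) ⊆ w := by
  intro x hx
  by_contra hxw
  obtain ⟨f, s, hf, hs⟩ := geometric_hahn_banach_closed_point w.convex w.isClosed hxw
  set p := (InnerProductSpace.toDual ℝ (E n)).symm f with hp
  have hfp : ∀ y, f y = inner ℝ y p := fun y => by
    rw [real_inner_comm, hp, InnerProductSpace.toDual_symm_apply]
  have h₁ : supportFun w p ≤ s := supportFun_le fun y hy => by
    rw [← hfp]; exact (hf y hy).le
  have h₂ := inner_le_supportFun (u := u) hx p
  rw [← hfp] at h₂
  linarith [h p]

theorem exists_norm_le (u : Conv n) : ∃ R, 0 ≤ R ∧ ∀ x ∈ u, ‖x‖ ≤ R := by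
  obtain ⟨R, hR, h⟩ := u.isBounded.exists_pos_norm_le
  exact ⟨R, hR.le, h⟩

theorem abs_supportFun_le_of_norm_le {u : Conv n} {R : ℝ} (h : ∀ x ∈ u, ‖x‖ ≤ R) (p : E n) :
    |supportFun u p| ≤ R * ‖p‖ := by
  obtain ⟨x, hx, e⟩ := exists_inner_eq_supportFun u p
  rw [← e]
  exact (abs_real_inner_le_norm x p).trans (by gcongr; exact h x hx)

theorem abs_supportFun_le_supNorm (u : Conv n) {p : E n} (hp : ‖p‖ = 1) :
    |supportFun u p| ≤ supNorm u := by
  obtain ⟨R, -, h⟩ := exists_norm_le u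
  refine le_ciSup (f := fun p : Metric.sphere (0 : E n) 1 => |supportFun u p|) ⟨R, ?_⟩
    ⟨p, by simpa using hp⟩
  rintro _ ⟨q, rfl⟩
  have := abs_supportFun_le_of_norm_le h q
  simpa using this

theorem supNorm_nonneg (u : Conv n) : 0 ≤ supNorm u := Real.iSup_nonneg fun _ => abs_nonneg _

theorem supNorm_le {u : Conv n} {C : ℝ} (hC : 0 ≤ C)
    (h : ∀ p : E n, ‖p‖ = 1 → |supportFun u p| ≤ C) : supNorm u ≤ C :=
  Real.iSup_le (fun p => h p (by simp)) hC

theorem supportFun_zero_right (u : Conv n) : supportFun u 0 = 0 := by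
  have := supportFun_smul_right le_rfl u (0 : E n)
  simpa using this

theorem abs_supportFun_le (u : Conv n) (p : E n) : |supportFun u p| ≤ supNorm u * ‖p‖ := by
  rcases eq_or_ne p 0 with rfl | hp
  · simp [supportFun_zero_right]
  have hp' : 0 < ‖p‖ := norm_pos_iff.2 hp
  have h := abs_supportFun_le_supNorm u (p := ‖p‖⁻¹ • p) (by
    rw [norm_smul, norm_inv, norm_norm, inv_mul_cancel₀ hp'.ne'])
  rw [supportFun_smul_right (by positivity), abs_mul, abs_of_nonneg (by positivity : 0 ≤ ‖p‖⁻¹),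
    inv_mul_le_iff₀ hp'] at h
  linarith

/-- Testing the support function in the direction `p = x` gives `‖x‖² ≤ supNorm u * ‖x‖`. -/
theorem norm_le_supNorm {u : Conv n} {x : E n} (hx : x ∈ u) : ‖x‖ ≤ supNorm u := by
  rcases eq_or_ne x 0 with rfl | h0
  · simpa using supNorm_nonneg u
  have h := (inner_le_supportFun hx x).trans ((le_abs_self _).trans (abs_supportFun_le u x))
  rw [real_inner_self_eq_norm_sq, sq] at h
  exact le_of_mul_le_mul_right h (norm_pos_iff.2 h0)

theorem supportFun_sub_le (u : Conv n) (p q : E n) :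
    |supportFun u p - supportFun u q| ≤ supNorm u * ‖p - q‖ := by
  have key : ∀ p q : E n, supportFun u p - supportFun u q ≤ supNorm u * ‖p - q‖ := by
    intro p q
    obtain ⟨x, hx, e⟩ := exists_inner_eq_supportFun u p
    have h₁ := inner_le_supportFun hx q
    have h₂ := real_inner_le_norm x (p - q)
    rw [inner_sub_right] at h₂
    have h₃ : ‖x‖ * ‖p - q‖ ≤ supNorm u * ‖p - q‖ := by gcongr; exact norm_le_supNorm hx
    linarith
  rw [abs_le]
  refine ⟨?_, key p q⟩
  have := key q p
  rw [norm_sub_rev] at this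
  linarith

theorem supportFun_sub_le_dist (u w : Conv n) (p : E n) :
    |supportFun u p - supportFun w p| ≤ dist u w * ‖p‖ := by
  have key : ∀ u w : Conv n, supportFun u p - supportFun w p ≤ dist u w * ‖p‖ := by
    intro u w
    obtain ⟨x, hx, e⟩ := exists_inner_eq_supportFun u p
    refine le_of_forall_pos_le_add fun ε hε => ?_
    -- Near-optimal points suffice; the slack `ε / (‖p‖ + 1)` costs at most `ε` after multiplication
    -- by `‖p‖`, also when `p = 0`.
    have hd : Metric.hausdorffDist (u : Set (E n)) w < dist u w + ε / (‖p‖ + 1) := by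
      rw [ConvexBody.hausdorffDist_coe]; have : 0 < ε / (‖p‖ + 1) := by positivity
      linarith
    obtain ⟨y, hy, hxy⟩ := Metric.exists_dist_lt_of_hausdorffDist_lt hx hd
      ConvexBody.hausdorffEDist_ne_top
    have h₁ := inner_le_supportFun (u := w) hy p
    have h₂ := real_inner_le_norm (x - y) p
    rw [inner_sub_left, ← dist_eq_norm] at h₂
    have h₃ : dist x y * ‖p‖ ≤ (dist u w + ε / (‖p‖ + 1)) * ‖p‖ := by gcongr
    have h₄ : ε / (‖p‖ + 1) * ‖p‖ ≤ ε := by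
      rw [div_mul_eq_mul_div, div_le_iff₀ (by positivity)]
      nlinarith [norm_nonneg p]
    rw [add_mul] at h₃
    linarith
  rw [abs_le]
  refine ⟨?_, key u w⟩
  have := key w u
  rw [dist_comm] at this
  linarith

theorem supNorm_le_add_dist (u w : Conv n) : supNorm u ≤ supNorm w + dist u w := by
  refine supNorm_le (add_nonneg (supNorm_nonneg w) dist_nonneg) fun p hp => ?_
  have h₁ := supportFun_sub_le_dist u w p
  have h₂ := abs_supportFun_le_supNorm w hp
  rw [hp, mul_one] at h₁
  have := abs_add_le (supportFun u p - supportFun w p) (supportFun w p)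
  rw [sub_add_cancel] at this
  linarith

theorem continuous_supNorm : Continuous (supNorm : Conv n → ℝ) := by
  refine (LipschitzWith.of_le_add fun u w => supNorm_le_add_dist u w).continuous

/-- The image of a convex body under a linear operator. -/
def map (L : E n →L[ℝ] E n) (u : Conv n) : Conv n where
  carrier := L '' u
  convex' := u.convex.linear_image (L : E n →ₗ[ℝ] E n)
  isCompact' := u.isCompact.image L.continuous
  nonempty' := u.nonempty.image _

theorem coe_map (L : E n →L[ℝ] E n) (u : Conv n) : (map L u : Set (E n)) = L '' u := rfl

theorem supportFun_map (L : E n →L[ℝ] E n) (u : Conv n) (p : E n) :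
    supportFun (map L u) p = supportFun u (ContinuousLinearMap.adjoint L p) := by
  rw [supportFun, supportFun, coe_map, image_image]
  simp only [ContinuousLinearMap.adjoint_inner_right]

theorem map_body_add (L : E n →L[ℝ] E n) (u w : Conv n) : map L (u + w) = map L u + map L w := by
  apply ConvexBody.ext
  simp only [coe_map, ConvexBody.coe_add, Set.image_add]

/-- The closed unit ball as a convex body. -/
def unitBall (n : ℕ) : Conv n where
  carrier := Metric.closedBall 0 1
  convex' := convex_closedBall _ _
  isCompact' := isCompact_closedBall _ _
  nonempty' := Metric.nonempty_closedBall.2 zero_le_one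

theorem mem_unitBall {x : E n} : x ∈ unitBall n ↔ ‖x‖ ≤ 1 := by
  rw [← mem_closedBall_zero_iff]; rfl

theorem supportFun_unitBall (p : E n) : supportFun (unitBall n) p = ‖p‖ := by
  apply le_antisymm
  · refine supportFun_le fun x hx => (real_inner_le_norm x p).trans ?_
    rw [mem_unitBall] at hx
    nlinarith [norm_nonneg p]
  · rcases eq_or_ne p 0 with rfl | hp
    · simp [supportFun_zero_right]
    have hp' : 0 < ‖p‖ := norm_pos_iff.2 hp
    have := inner_le_supportFun (u := unitBall n) (x := ‖p‖⁻¹ • p) (by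
      rw [mem_unitBall, norm_smul, norm_inv, norm_norm, inv_mul_cancel₀ hp'.ne']) p
    rw [real_inner_smul_left, real_inner_self_eq_norm_sq] at this
    calc ‖p‖ = ‖p‖⁻¹ * ‖p‖ ^ 2 := by field_simp
      _ ≤ _ := this

/-- A single point as a convex body. -/
def point (x : E n) : Conv n where
  carrier := {x}
  convex' := convex_singleton _
  isCompact' := isCompact_singleton
  nonempty' := singleton_nonempty _

theorem coe_point (x : E n) : (point x : Set (E n)) = {x} := rfl

end Support

/-! ### Elementary properties of the volume -/

section Volume

theorem volume_ne_top (u : Conv n) : volume (u : Set (E n)) ≠ ⊤ := u.isCompact.measure_lt_top.ne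

theorem vol_nonneg (u : Conv n) : 0 ≤ vol u := ENNReal.toReal_nonneg

theorem vol_mono {u w : Conv n} (h : (u : Set (E n)) ⊆ w) : vol u ≤ vol w :=
  ENNReal.toReal_mono (volume_ne_top w) (measure_mono h)

theorem vol_add_point (u : Conv n) (x : E n) : vol (u + point x) = vol u := by
  rw [vol, vol, ConvexBody.coe_add, coe_point, Set.add_singleton]
  congr 1
  rw [image_add_right, measure_preimage_add_right]

theorem vol_map (L : E n →L[ℝ] E n) (u : Conv n) : vol (map L u) = |L.det| * vol u := by
  rw [vol, vol, coe_map, Measure.addHaar_image_continuousLinearMap, ENNReal.toReal_mul,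
    ENNReal.toReal_ofReal (abs_nonneg _)]

end Volume

/-! ### Lipschitz dependence of the volume on the support function -/

section VolumeLipschitz

/-- The segment `[0, v]` as a convex body. -/
def seg (v : E n) : Conv n where
  carrier := segment ℝ 0 v
  convex' := convex_segment _ _
  isCompact' := by
    rw [← convexHull_pair]
    exact (Set.toFinite {(0 : E n), v}).isCompact_convexHull ℝ
  nonempty' := ⟨0, left_mem_segment _ _ _⟩

theorem mem_seg {v x : E n} : x ∈ seg v ↔ ∃ a ∈ Icc (0 : ℝ) 1, a • v = x := by
  change x ∈ segment ℝ 0 v ↔ _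
  rw [segment_eq_image]
  simp

theorem mem_add_smul_seg {w : Conv n} {v x : E n} {c : ℝ} (hc : 0 ≤ c) :
    x ∈ w + c • seg v ↔ ∃ a ∈ Icc (0 : ℝ) c, ∃ k ∈ w, k + a • v = x := by
  simp only [mem_add_iff, mem_smul_iff, mem_seg]
  constructor
  · rintro ⟨k, hk, _, ⟨_, ⟨a, ha, rfl⟩, rfl⟩, rfl⟩
    exact ⟨c * a, ⟨mul_nonneg hc ha.1, mul_le_of_le_one_right hc ha.2⟩, k, hk, by rw [mul_smul]⟩
  · rintro ⟨a, ha, k, hk, rfl⟩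
    rcases hc.eq_or_lt with rfl | hc
    · have : a = 0 := le_antisymm ha.2 ha.1
      subst this
      exact ⟨k, hk, 0, ⟨0, ⟨0, by simp, by simp⟩, by simp⟩, by simp⟩
    · refine ⟨k, hk, _, ⟨_, ⟨a / c, ⟨div_nonneg ha.1 hc.le, (div_le_one hc).2 ha.2⟩, rfl⟩, rfl⟩, ?_⟩
      rw [smul_smul, mul_div_cancel₀ _ hc.ne']

theorem subset_add_smul_seg (w : Conv n) (v : E n) {c : ℝ} (hc : 0 ≤ c) :
    (w : Set (E n)) ⊆ (w + c • seg v : Conv n) := fun x hx =>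
  (mem_add_smul_seg hc).2 ⟨0, ⟨le_rfl, hc⟩, x, hx, by simp⟩

theorem subset_add_smul_seg_of_le (w : Conv n) (v : E n) {s t : ℝ} (hs : 0 ≤ s) (hst : s ≤ t) :
    ((w + s • seg v : Conv n) : Set (E n)) ⊆ (w + t • seg v : Conv n) := by
  intro x hx
  obtain ⟨a, ha, k, hk, rfl⟩ := (mem_add_smul_seg hs).1 hx
  exact (mem_add_smul_seg (hs.trans hst)).2 ⟨a, ⟨ha.1, ha.2.trans hst⟩, k, hk, rfl⟩

theorem vol_sdiff {u w : Conv n} (h : (u : Set (E n)) ⊆ w) :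
    (volume ((w : Set (E n)) \ u)).toReal = vol w - vol u := by
  rw [measure_sdiff h u.isClosed.nullMeasurableSet (volume_ne_top u),
    ENNReal.toReal_sub_of_le (measure_mono h) (volume_ne_top w)]
  rfl

/-- The increments of the volume along a segment do not decrease: a translate of the first increment
is contained in any later one. -/
theorem vol_add_seg_increment (w : Conv n) (v : E n) {s t : ℝ} (hs : 0 ≤ s) (ht : 0 ≤ t) :
    vol (w + t • seg v) - vol w ≤ vol (w + (s + t) • seg v) - vol (w + s • seg v) := by
  rw [← vol_sdiff (subset_add_smul_seg w v ht),
    ← vol_sdiff (subset_add_smul_seg_of_le w v hs (le_add_of_nonneg_right ht)),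
    ← measure_preimage_add_right volume (-(s • v))
      (((w + t • seg v : Conv n) : Set (E n)) \ (w : Set (E n)))]
  refine ENNReal.toReal_mono (ne_top_of_le_ne_top (volume_ne_top _) (measure_mono sdiff_subset))
    (measure_mono ?_)
  rintro x ⟨hx, hxw⟩
  obtain ⟨a, ha, k, hk, hka⟩ := (mem_add_smul_seg ht).1 hx
  have hx' : x = k + (s + a) • v := by
    rw [add_smul, add_left_comm, hka]; simp
  refine ⟨(mem_add_smul_seg (add_nonneg hs ht)).2
    ⟨s + a, ⟨add_nonneg hs ha.1, by linarith [ha.2]⟩, k, hk, hx'.symm⟩, fun hxs => hxw ?_⟩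
  obtain ⟨b, hb, l, hl, hlb⟩ := (mem_add_smul_seg hs).1 hxs
  -- On the line in direction `v`, the point `x - s v` equals both `k + a v` and `l - (s - b) v`. It
  -- therefore lies between `k` and `l`, which belong to the convex set `w`.
  change x + -(s • v) ∈ w
  rcases (add_nonneg ha.1 (sub_nonneg.2 hb.2)).eq_or_lt with h0 | h0
  · have hbs : b = s := by linarith [ha.1, hb.2]
    rw [← hlb, hbs]
    simpa using hl
  · have := w.convex hk hl (div_nonneg (sub_nonneg.2 hb.2) h0.le) (div_nonneg ha.1 h0.le)
      (by rw [← add_div, add_comm, div_self h0.ne'])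
    suffices h : x + -(s • v) = ((s - b) / (a + (s - b))) • k + (a / (a + (s - b))) • l by
      rw [h]; exact this
    have hl' : l = k + (s + a - b) • v := by
      rw [sub_smul, add_sub, ← hx', ← hlb]; abel
    have hc : a / (a + (s - b)) * (s + a - b) = a := by
      rw [show s + a - b = a + (s - b) by ring, div_mul_cancel₀ _ h0.ne']
    rw [hl', smul_add, ← add_assoc, ← add_smul, ← add_div, add_comm (s - b) a, div_self h0.ne',
      smul_smul, one_smul, hc]
    exact hka.symm

/-- Summing the nondecreasing increments: `m` copies of the first one cost no more than one long
step. -/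
theorem vol_add_nsmul_seg (w : Conv n) (v : E n) {t : ℝ} (ht : 0 ≤ t) (m : ℕ) :
    m * (vol (w + t • seg v) - vol w) ≤ vol (w + (m * t) • seg v) - vol w := by
  induction m with
  | zero =>
    have := vol_mono (subset_add_smul_seg w v le_rfl)
    simpa using this
  | succ m ih =>
    have := vol_add_seg_increment w v (s := m * t) (by positivity) ht
    push_cast
    rw [add_mul, add_mul, one_mul, one_mul]
    linarith

/-- Along `S` the volume grows at most linearly, uniformly on bounded sets. -/
def GrowsLinearly (S : Conv n) : Prop :=
  ∀ R : ℝ, ∃ C, 0 ≤ C ∧ ∀ w : Conv n, (∀ x ∈ w, ‖x‖ ≤ R) → ∀ c ∈ Icc (0 : ℝ) 1,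
    vol (w + c • S) ≤ vol w + C * c

theorem norm_le_of_mem_add_smul {w S : Conv n} {R R' c : ℝ} (hw : ∀ x ∈ w, ‖x‖ ≤ R)
    (hS : ∀ x ∈ S, ‖x‖ ≤ R') (hc : c ∈ Icc (0 : ℝ) 1) :
    ∀ x ∈ w + c • S, ‖x‖ ≤ R + R' := by
  intro x hx
  obtain ⟨a, ha, b, hb, rfl⟩ := mem_add_iff.1 hx
  obtain ⟨y, hy, rfl⟩ := mem_smul_iff.1 hb
  refine (norm_add_le _ _).trans (add_le_add (hw a ha) ?_)
  rw [norm_smul, Real.norm_of_nonneg hc.1]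
  exact (mul_le_of_le_one_left (norm_nonneg _) hc.2).trans (hS y hy)

theorem vol_le_of_norm_le {w : Conv n} {R : ℝ} (hw : ∀ x ∈ w, ‖x‖ ≤ R) :
    vol w ≤ (volume (Metric.closedBall (0 : E n) R)).toReal :=
  ENNReal.toReal_mono (isCompact_closedBall _ _).measure_lt_top.ne
    (measure_mono fun x hx => mem_closedBall_zero_iff.2 (hw x hx))

theorem GrowsLinearly.seg (v : E n) : GrowsLinearly (seg v) := by
  intro R
  set M := (volume (Metric.closedBall (0 : E n) (R + ‖v‖))).toReal
  have hM : 0 ≤ M := ENNReal.toReal_nonneg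
  refine ⟨2 * M, by positivity, fun w hw c hc => ?_⟩
  have hv : ∀ x ∈ ConvSemiflow.seg v, ‖x‖ ≤ ‖v‖ := by
    intro x hx
    obtain ⟨a, ha, rfl⟩ := mem_seg.1 hx
    rw [norm_smul, Real.norm_of_nonneg ha.1]
    exact mul_le_of_le_one_left (norm_nonneg _) ha.2
  have bd : ∀ t ∈ Icc (0 : ℝ) 1, vol (w + t • ConvSemiflow.seg v) ≤ M := fun t ht =>
    vol_le_of_norm_le (norm_le_of_mem_add_smul hw hv ht)
  rcases hc.1.eq_or_lt with rfl | hc0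
  · have h2 : ((w + (0 : ℝ) • ConvSemiflow.seg v : Conv n) : Set (E n)) ⊆ w := by
      intro x hx
      obtain ⟨a, ha, k, hk, rfl⟩ := (mem_add_smul_seg le_rfl).1 hx
      have : a = 0 := le_antisymm ha.2 ha.1
      simpa [this] using hk
    simpa using vol_mono h2
  -- About `1 / c` steps of length `c` fit into one unit step, whose total increment is at most `M`.
  -- Hence `m * d ≤ M`, and `2 m c ≥ 1` turns this into `d ≤ 2 M c`.
  · set m := ⌊1 / c⌋₊
    have hm1 : (m : ℝ) * c ≤ 1 := by
      have := Nat.floor_le (a := 1 / c) (by positivity)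
      rwa [le_div_iff₀ hc0] at this
    have hm2 : 1 < ((m : ℝ) + 1) * c := by
      have := Nat.lt_floor_add_one (1 / c)
      rwa [div_lt_iff₀ hc0] at this
    have hm3 : 1 ≤ 2 * (m * c) := by
      have : 1 ≤ m := by
        rw [Nat.one_le_floor_iff, le_div_iff₀ hc0, one_mul]; exact hc.2
      have : (1 : ℝ) ≤ m := by exact_mod_cast this
      nlinarith
    have h1 := vol_add_nsmul_seg w v hc.1 m
    have h2 := bd _ ⟨by positivity, hm1⟩
    have h3 := vol_nonneg w
    set d := vol (w + c • ConvSemiflow.seg v) - vol w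
    have hd : 0 ≤ d := sub_nonneg.2 (vol_mono (subset_add_smul_seg w v hc.1))
    have h4 : m * d ≤ M := by linarith
    have : d ≤ 2 * M * c := by
      calc d ≤ 2 * (m * c) * d := le_mul_of_one_le_left hd hm3
        _ = 2 * c * (m * d) := by ring
        _ ≤ 2 * c * M := by gcongr
        _ = _ := by ring
    linarith

theorem GrowsLinearly.add {S T : Conv n} (hS : GrowsLinearly S) (hT : GrowsLinearly T) :
    GrowsLinearly (S + T) := by
  intro R
  obtain ⟨R', hR', hSR⟩ := exists_norm_le S
  obtain ⟨C, hC, h⟩ := hS R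
  obtain ⟨C', hC', h'⟩ := hT (R + R')
  refine ⟨C + C', by positivity, fun w hw c hc => ?_⟩
  have h1 := h w hw c hc
  have h2 := h' (w + c • S) (norm_le_of_mem_add_smul hw hSR hc) c hc
  rw [smul_add, ← add_assoc]
  linarith

theorem GrowsLinearly.zero : GrowsLinearly (0 : Conv n) := fun R =>
  ⟨0, le_rfl, fun w _ c _ => by
    have h : c • (0 : Conv n) = 0 := ConvexBody.ext (by
      rw [ConvexBody.coe_smul, ConvexBody.coe_zero, smul_zero])
    rw [h]; simp⟩

theorem GrowsLinearly.sum {ι : Type*} (s : Finset ι) (S : ι → Conv n)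
    (h : ∀ i ∈ s, GrowsLinearly (S i)) : GrowsLinearly (∑ i ∈ s, S i) :=
  Finset.sum_induction S GrowsLinearly (fun _ _ => .add) .zero h

theorem sum_mem_sum {ι : Type*} (s : Finset ι) (S : ι → Conv n) (x : ι → E n)
    (h : ∀ i ∈ s, x i ∈ S i) : ∑ i ∈ s, x i ∈ ∑ i ∈ s, S i := by
  classical
  induction s using Finset.induction_on with
  | empty => exact mem_singleton _
  | insert i s hi ih =>
    rw [Finset.sum_insert hi, Finset.sum_insert hi]
    exact mem_add_iff.2 ⟨_, h i (Finset.mem_insert_self _ _), _,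
      ih fun j hj => h j (Finset.mem_insert_of_mem hj), rfl⟩

/-- The ball lies in a cube, which is a Minkowski sum of coordinate segments, and linear growth is
inherited by sums. -/
theorem GrowsLinearly.unitBall : GrowsLinearly (unitBall n) := by
  set b := EuclideanSpace.basisFun (Fin n) ℝ
  have hS : GrowsLinearly (∑ i, (ConvSemiflow.seg (b i) + ConvSemiflow.seg (-b i)) : Conv n) :=
    GrowsLinearly.sum _ _ fun i _ => .add (.seg _) (.seg _)
  have hsub : (ConvSemiflow.unitBall n : Set (E n)) ⊆
      (∑ i, (ConvSemiflow.seg (b i) + ConvSemiflow.seg (-b i)) : Conv n) := by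
    intro x hx
    rw [SetLike.mem_coe, mem_unitBall] at hx
    rw [← b.sum_repr x]
    refine sum_mem_sum _ _ _ fun i _ => ?_
    have hi : |b.repr x i| ≤ 1 := by
      have := b.repr_apply_apply x i
      rw [this]
      exact (abs_real_inner_le_norm _ _).trans (by rw [b.norm_eq_one, one_mul]; exact hx)
    rcases le_total 0 (b.repr x i) with h | h
    · exact mem_add_iff.2 ⟨_, mem_seg.2 ⟨_, ⟨h, (abs_le.1 hi).2⟩, rfl⟩, 0,
        mem_seg.2 ⟨0, by simp, by simp⟩, add_zero _⟩
    · exact mem_add_iff.2 ⟨0, mem_seg.2 ⟨0, by simp, by simp⟩, _,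
        mem_seg.2 ⟨-b.repr x i, ⟨by linarith, by linarith [(abs_le.1 hi).1]⟩, rfl⟩, by simp⟩
  intro R
  obtain ⟨C, hC, h⟩ := hS R
  refine ⟨C, hC, fun w hw c hc => (vol_mono ?_).trans (h w hw c hc)⟩
  rw [ConvexBody.coe_add, ConvexBody.coe_add, ConvexBody.coe_smul, ConvexBody.coe_smul]
  gcongr

/-- The volume is Lipschitz with respect to support functions, uniformly on bounded sets. -/
theorem exists_vol_le_add (n : ℕ) (R : ℝ) : ∃ C, 0 ≤ C ∧ ∀ u w : Conv n, supNorm w ≤ R →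
    ∀ c ∈ Icc (0 : ℝ) 1, (∀ p, supportFun u p ≤ supportFun w p + c * ‖p‖) →
      vol u ≤ vol w + C * c := by
  obtain ⟨C, hC, h⟩ := GrowsLinearly.unitBall (n := n) R
  refine ⟨C, hC, fun u w hw c hc huw => (vol_mono ?_).trans
    (h w (fun x hx => (norm_le_supNorm hx).trans hw) c hc)⟩
  refine subset_of_supportFun_le fun p => ?_
  rw [supportFun_add, supportFun_smul hc.1, supportFun_unitBall]
  exact huw p

/-- A one-sided bound is enough: taking `p = x` bounds the norm of every point `x` of `u`, and this
controls `|supportFun u|`. -/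
theorem supNorm_le_of_supportFun_le {u w : Conv n} {c : ℝ} (hc : 0 ≤ c)
    (h : ∀ p, supportFun u p ≤ supportFun w p + c * ‖p‖) : supNorm u ≤ supNorm w + c := by
  have hn := add_nonneg (supNorm_nonneg w) hc
  refine supNorm_le hn fun p hp => ?_
  have hx : ∀ x ∈ u, ‖x‖ ≤ supNorm w + c := by
    intro x hx
    rcases eq_or_ne x 0 with rfl | h0
    · simpa using hn
    have h1 := (inner_le_supportFun hx x).trans (h x)
    have h2 := (le_abs_self _).trans (abs_supportFun_le w x)
    rw [real_inner_self_eq_norm_sq, sq] at h1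
    exact le_of_mul_le_mul_right (by linarith) (norm_pos_iff.2 h0)
  simpa [hp] using abs_supportFun_le_of_norm_le hx p

theorem exists_abs_vol_sub_le (n : ℕ) (R : ℝ) : ∃ C, 0 ≤ C ∧ ∀ u w : Conv n, supNorm w ≤ R →
    ∀ c ∈ Icc (0 : ℝ) 1, (∀ p, |supportFun u p - supportFun w p| ≤ c * ‖p‖) →
      |vol u - vol w| ≤ C * c := by
  -- The estimate is used with both bodies as the base; `supNorm u ≤ R + 1` because `c ≤ 1`.
  obtain ⟨C, hC, h⟩ := exists_vol_le_add n (R + 1)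
  refine ⟨C, hC, fun u w hw c hc huw => ?_⟩
  have h1 : ∀ p, supportFun u p ≤ supportFun w p + c * ‖p‖ := fun p => by
    linarith [(abs_le.1 (huw p)).2]
  have h2 : ∀ p, supportFun w p ≤ supportFun u p + c * ‖p‖ := fun p => by
    linarith [(abs_le.1 (huw p)).1]
  have h3 := supNorm_le_of_supportFun_le hc.1 h1
  have h4 := h u w (by linarith) c hc h1
  have h5 := h w u (by linarith [hc.2]) c hc h2
  rw [abs_le]
  constructor <;> linarith

/-- If the support functions converge uniformly on the sphere, the volumes converge. -/
theorem tendsto_vol_of_supportFun {ι : Type*} {l : Filter ι} {u : ι → Conv n} {w : Conv n}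
    {c : ι → ℝ} (hc : Tendsto c l (𝓝 0)) (hc0 : ∀ᶠ i in l, 0 ≤ c i)
    (h : ∀ᶠ i in l, ∀ p, |supportFun (u i) p - supportFun w p| ≤ c i * ‖p‖) :
    Tendsto (fun i => vol (u i)) l (𝓝 (vol w)) := by
  obtain ⟨C, hC, hV⟩ := exists_abs_vol_sub_le n (supNorm w)
  rw [tendsto_iff_norm_sub_tendsto_zero]
  refine squeeze_zero' (g := fun i => C * c i) (.of_forall fun _ => norm_nonneg _) ?_
    (by simpa using hc.const_mul C)
  filter_upwards [hc0, h, hc.eventually_le_const zero_lt_one] with i h0 hi h1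
  exact hV _ _ le_rfl _ ⟨h0, h1⟩ hi

theorem continuous_vol : Continuous (vol : Conv n → ℝ) := by
  refine continuous_iff_continuousAt.2 fun w => ?_
  refine tendsto_vol_of_supportFun (c := fun u => dist u w) ?_ (.of_forall fun _ => dist_nonneg)
    (.of_forall fun u p => supportFun_sub_le_dist u w p)
  exact Continuous.tendsto' (by fun_prop) _ _ (dist_self w)

end VolumeLipschitz

/-! ### Right derivative of the volume at a body without interior -/

section Degenerate

theorem supportFun_map_sub_le (L M : E n →L[ℝ] E n) (w : Conv n) (p : E n) :
    |supportFun (map L w) p - supportFun (map M w) p| ≤ supNorm w * ‖L - M‖ * ‖p‖ := by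
  rw [supportFun_map, supportFun_map, mul_assoc]
  refine (supportFun_sub_le w _ _).trans
    (mul_le_mul_of_nonneg_left ?_ (supNorm_nonneg w))
  rw [← sub_apply, ← map_sub]
  refine (ContinuousLinearMap.le_opNorm _ _).trans ?_
  rw [LinearIsometryEquiv.norm_map]

/-- The projection onto the line spanned by `e` (if `‖e‖ = 1`). -/
def lineProj (e : E n) : E n →L[ℝ] E n := (innerSL ℝ e).smulRight e

theorem lineProj_apply (e x : E n) : lineProj e x = (inner ℝ e x : ℝ) • e := rfl

/-- A rank-one perturbation of the identity: this is the matrix determinant lemma. -/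
theorem det_one_add_smul_lineProj {e : E n} (he : ‖e‖ = 1) (c : ℝ) :
    (1 + c • lineProj e).det = 1 + c := by
  set b := (EuclideanSpace.basisFun (Fin n) ℝ).toBasis
  rw [ContinuousLinearMap.det, ← LinearMap.det_toMatrix b]
  have : LinearMap.toMatrix b b ((1 + c • lineProj e : E n →L[ℝ] E n) : E n →ₗ[ℝ] E n) =
      1 + Matrix.replicateCol Unit (c • (e : Fin n → ℝ)) *
        Matrix.replicateRow Unit (e : Fin n → ℝ) := by
    ext i j
    simp [b, LinearMap.toMatrix_apply, lineProj_apply, Matrix.one_apply, Matrix.mul_apply,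
      eq_comm, EuclideanSpace.inner_single_right]
    exact Or.inl (mul_comm _ _)
  rw [this, Matrix.det_one_add_replicateCol_mul_replicateRow, dotProduct_smul]
  have h : (e : Fin n → ℝ) ⬝ᵥ (e : Fin n → ℝ) = 1 := by
    have := EuclideanSpace.inner_eq_star_dotProduct e e
    rw [real_inner_self_eq_norm_sq, he] at this
    simpa using this.symm
  rw [h]; simp

/-- A null convex set has empty interior, so its affine span is proper; `e` is a unit normal to the
direction of that span. -/
theorem exists_subset_hyperplane {u : Conv n} (h : vol u = 0) :
    ∃ e : E n, ‖e‖ = 1 ∧ ∀ x ∈ u, ∀ y ∈ u, inner ℝ e (x - y) = 0 := by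
  have hi : ¬ (interior (u : Set (E n))).Nonempty := fun hne => by
    have h1 := isOpen_interior.measure_pos volume hne
    have h2 : 0 < volume (u : Set (E n)) := h1.trans_le (measure_mono interior_subset)
    rw [vol, ENNReal.toReal_eq_zero_iff] at h
    exact h.elim h2.ne' (volume_ne_top u)
  rw [u.convex.interior_nonempty_iff_affineSpan_eq_top] at hi
  rw [← AffineSubspace.direction_eq_top_iff_of_nonempty
    ((affineSpan_nonempty ℝ).2 u.nonempty)] at hi
  have : (affineSpan ℝ (u : Set (E n))).directionᗮ ≠ ⊥ := fun hb =>
    hi (Submodule.orthogonal_eq_bot_iff.1 hb)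
  obtain ⟨e, he, he0⟩ := Submodule.exists_mem_ne_zero_of_ne_bot this
  have he' : 0 < ‖e‖ := norm_pos_iff.2 he0
  refine ⟨‖e‖⁻¹ • e, by rw [norm_smul, norm_inv, norm_norm, inv_mul_cancel₀ he'.ne'],
    fun x hx y hy => ?_⟩
  rw [real_inner_smul_left, real_inner_comm, Submodule.inner_right_of_mem_orthogonal _ he, mul_zero]
  exact AffineSubspace.vsub_mem_direction (subset_affineSpan ℝ _ hx) (subset_affineSpan ℝ _ hy)

theorem zero_smul_body (w : Conv n) : (0 : ℝ) • w = 0 :=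
  ConvexBody.ext (by
    rw [ConvexBody.coe_smul, ConvexBody.coe_zero, Set.zero_smul_set w.nonempty])

/-- A body in a hyperplane: rescaling in the normal direction reduces the derivative of the volume
to the continuity of the volume. -/
theorem differentiableWithinAt_vol_add_of_subset {u : Conv n} (hu0 : vol u = 0) {e : E n}
    (he : ‖e‖ = 1) (hu : ∀ x ∈ u, inner ℝ e x = 0) (w : Conv n) :
    DifferentiableWithinAt ℝ (fun ρ : ℝ => vol (u + ρ • w)) (Ici 0) 0 := by
  set Q := lineProj e
  set S : ℝ → E n →L[ℝ] E n := fun ρ => Q + ρ • (1 - Q)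
  have hQQ : ∀ x, Q (Q x) = Q x := fun x => by
    simp only [Q, lineProj_apply, real_inner_smul_right, real_inner_self_eq_norm_sq, he]
    simp
  -- Let `D = 1 + (ρ - 1) Q`. It fixes `u` pointwise, has determinant `ρ`, and `D ∘ S ρ` is
  -- multiplication by `ρ`. Thus `u + ρ w` is the image under `D` of `u + S ρ (w)`, and the
  -- difference quotient is simply the volume of the latter.
  have key : ∀ ρ : ℝ, 0 < ρ → vol (u + ρ • w) = ρ * vol (u + map (S ρ) w) := by
    intro ρ hρ
    have hd : |(1 + (ρ - 1) • Q).det| = ρ := by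
      rw [det_one_add_smul_lineProj he, add_sub_cancel, abs_of_pos hρ]
    have hm := vol_map (1 + (ρ - 1) • Q) (u + map (S ρ) w)
    rw [hd] at hm
    rw [← hm, map_body_add]
    congr 2
    · apply ConvexBody.ext
      rw [coe_map]
      have : EqOn (1 + (ρ - 1) • Q : E n →L[ℝ] E n) id (u : Set (E n)) := fun x hx => by
        simp [Q, lineProj_apply, hu x hx]
      rw [this.image_eq, image_id]
    · apply ConvexBody.ext
      rw [coe_map, coe_map, image_image, ConvexBody.coe_smul, ← image_smul]
      refine image_congr fun x _ => ?_
      simp only [S, add_apply, smul_apply,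
        sub_apply, one_apply_eq_self, map_add, map_smul, map_sub,
        hQQ]
      module
  refine HasDerivWithinAt.differentiableWithinAt (f' := vol (u + map Q w)) ?_
  rw [hasDerivWithinAt_iff_tendsto_slope, Ici_sdiff_left]
  have ht : Tendsto (fun ρ : ℝ => vol (u + map (S ρ) w)) (𝓝[>] 0) (𝓝 (vol (u + map Q w))) := by
    refine tendsto_vol_of_supportFun (c := fun ρ => supNorm w * ‖1 - Q‖ * ρ) ?_ ?_ ?_
    · exact ((continuous_const.mul continuous_id).tendsto' 0 0 (by simp)).mono_left
        nhdsWithin_le_nhds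
    · filter_upwards [self_mem_nhdsWithin] with ρ hρ
      have := supNorm_nonneg w
      have : 0 ≤ ρ := (mem_Ioi.1 hρ).le
      positivity
    · filter_upwards [self_mem_nhdsWithin] with ρ hρ p
      rw [supportFun_add, supportFun_add, add_sub_add_left_eq_sub]
      refine (supportFun_map_sub_le _ _ _ _).trans (le_of_eq ?_)
      simp only [S, add_sub_cancel_left, norm_smul, Real.norm_of_nonneg (mem_Ioi.1 hρ).le]
      ring
  refine ht.congr' ?_
  filter_upwards [self_mem_nhdsWithin] with ρ hρ
  have hρ0 : ρ ≠ 0 := (mem_Ioi.1 hρ).ne'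
  rw [slope_def_field, key ρ hρ, zero_smul_body, add_zero, hu0]
  field_simp
  simp

theorem vol_add_add_point (u w : Conv n) (x y : E n) (ρ : ℝ) :
    vol ((u + point x) + ρ • (w + point y)) = vol (u + ρ • w) := by
  have : ρ • point y = point (ρ • y) :=
    ConvexBody.ext (by rw [ConvexBody.coe_smul, coe_point, coe_point, Set.smul_set_singleton])
  rw [smul_add, this, add_add_add_comm]
  have h2 : point x + point (ρ • y) = point (x + ρ • y) :=
    ConvexBody.ext (by rw [ConvexBody.coe_add]; simp only [coe_point, Set.singleton_add_singleton])
  rw [h2, vol_add_point]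

theorem mem_add_point_neg {u : Conv n} {x y : E n} : y ∈ u + point (-x) ↔ y + x ∈ u := by
  rw [mem_add_iff]
  constructor
  · rintro ⟨a, ha, b, rfl, rfl⟩
    simpa using ha
  · exact fun h => ⟨_, h, -x, rfl, by simp⟩

theorem differentiableWithinAt_vol_add_of_vol_eq_zero {u : Conv n} (hu : vol u = 0) (w : Conv n) :
    DifferentiableWithinAt ℝ (fun ρ : ℝ => vol (u + ρ • w)) (Ici 0) 0 := by
  obtain ⟨e, he, h⟩ := exists_subset_hyperplane hu
  obtain ⟨x, hx⟩ := u.nonempty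
  have := differentiableWithinAt_vol_add_of_subset (u := u + point (-x))
    (by rw [vol_add_point, hu]) he (fun y hy => by
      have := h _ (mem_add_point_neg.1 hy) x hx
      rwa [add_sub_cancel_right] at this) (w + point 0)
  simpa only [vol_add_add_point] using this

end Degenerate

/-! ### Polar coordinates and the right derivative at a body with interior -/

section Polar

theorem gauge_pos_of_sphere {K : Set (E n)} (h0 : K ∈ 𝓝 0) (hb : Bornology.IsBounded K)
    (θ : Metric.sphere (0 : E n) 1) : 0 < gauge K (θ : E n) :=
  (gauge_pos (absorbent_nhds_zero h0) (NormedSpace.isVonNBounded_iff ℝ |>.2 hb)).2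
    (ne_zero_of_mem_unit_sphere θ)

/-- The volume of a convex body in polar coordinates. -/
theorem volume_eq_lintegral_gauge (hn : n ≠ 0) {K : Set (E n)} (hK : Convex ℝ K) (h0 : K ∈ 𝓝 0)
    (hb : Bornology.IsBounded K) :
    volume K = ∫⁻ θ : Metric.sphere (0 : E n) 1,
      ENNReal.ofReal ((gauge K (θ : E n))⁻¹ ^ n / n) ∂(volume : Measure (E n)).toSphere := by
  obtain ⟨m, rfl⟩ := Nat.exists_eq_succ_of_ne_zero hn
  have hg : Continuous (gauge K) := continuous_gauge hK h0
  set S : Set (Metric.sphere (0 : E (m + 1)) 1 × Ioi (0 : ℝ)) :=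
    {q | (q.2 : ℝ) * gauge K (q.1 : E (m + 1)) < 1}
  have hS : MeasurableSet S := by
    refine (isOpen_lt ?_ continuous_const).measurableSet
    exact (continuous_subtype_val.comp continuous_snd).mul
      (hg.comp (continuous_subtype_val.comp continuous_fst))
  have hmp := (Measure.measurePreserving_homeomorphUnitSphereProd
    (volume : Measure (E (m + 1)))).measure_preimage hS.nullMeasurableSet
  -- The region below the radial function `1 / gauge` is the interior of `K` without the origin; the
  -- origin and the frontier of a convex set are null.
  have hpre : (Subtype.val '' ((homeomorphUnitSphereProd (E (m + 1))) ⁻¹' S)) =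
      interior K \ {0} := by
    ext x
    have hx : ∀ h : x ∈ ({0}ᶜ : Set (E (m + 1))),
        (⟨x, h⟩ : ({0}ᶜ : Set (E (m + 1)))) ∈ (homeomorphUnitSphereProd (E (m + 1))) ⁻¹' S ↔
          x ∈ interior K := by
      intro h
      have hx0 : ‖x‖ ≠ 0 := norm_ne_zero_iff.2 h
      rw [← gauge_lt_one_iff_mem_interior hK h0, mem_preimage]
      simp only [S, mem_ofPred_eq, homeomorphUnitSphereProd_apply_fst_coe,
        homeomorphUnitSphereProd_apply_snd_coe]
      rw [gauge_smul_of_nonneg (by positivity), smul_eq_mul, mul_inv_cancel_left₀ hx0]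
    constructor
    · rintro ⟨⟨y, hy⟩, hyS, rfl⟩
      exact ⟨(hx hy).1 hyS, hy⟩
    · rintro ⟨h1, h2⟩
      exact ⟨⟨x, h2⟩, (hx h2).2 h1, rfl⟩
  rw [comap_subtype_coe_apply (measurableSet_singleton _).compl, hpre,
    measure_sdiff_null (measure_singleton _),
    measure_congr (interior_ae_eq_of_null_frontier (hK.addHaar_frontier volume))] at hmp
  rw [hmp, Measure.prod_apply hS]
  refine lintegral_congr fun θ => ?_
  have hθ := gauge_pos_of_sphere h0 hb θ
  have : Prod.mk θ ⁻¹' S = Iio (⟨(gauge K (θ : E (m + 1)))⁻¹, inv_pos.2 hθ⟩ : Ioi (0 : ℝ)) := by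
    ext ⟨s, hs⟩
    change s * gauge K (θ : E (m + 1)) < 1 ↔ s < (gauge K (θ : E (m + 1)))⁻¹
    rw [lt_inv_comm₀ hs hθ, ← one_div, lt_div_iff₀ hs, mul_comm]
  rw [this, Measure.volumeIoiPow_apply_Iio]
  simp

theorem continuous_polar {K : Set (E n)} (hK : Convex ℝ K) (h0 : K ∈ 𝓝 0)
    (hb : Bornology.IsBounded K) :
    Continuous fun θ : Metric.sphere (0 : E n) 1 => (gauge K (θ : E n))⁻¹ ^ n / (n : ℝ) :=
  ((((continuous_gauge hK h0).comp continuous_subtype_val).inv₀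
    fun θ => (gauge_pos_of_sphere h0 hb θ).ne').pow n).div_const _

theorem integrable_polar {f : Metric.sphere (0 : E n) 1 → ℝ} (hf : Continuous f) :
    Integrable f (volume : Measure (E n)).toSphere :=
  hf.integrable_of_hasCompactSupport (HasCompactSupport.of_compactSpace f)

theorem vol_eq_integral_gauge (hn : n ≠ 0) {K : Conv n} (h0 : (K : Set (E n)) ∈ 𝓝 0) :
    vol K = ∫ θ : Metric.sphere (0 : E n) 1,
      (gauge (K : Set (E n)) (θ : E n))⁻¹ ^ n / (n : ℝ) ∂(volume : Measure (E n)).toSphere := by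
  rw [vol, volume_eq_lintegral_gauge hn K.convex h0 K.isBounded,
    integral_eq_lintegral_of_nonneg_ae]
  · exact .of_forall fun θ => div_nonneg (pow_nonneg (inv_nonneg.2 (gauge_nonneg _)) _)
      (Nat.cast_nonneg _)
  · exact (integrable_polar (continuous_polar K.convex h0 K.isBounded)).aestronglyMeasurable

theorem exists_one_add_pow_le (n : ℕ) {c : ℝ} (hc : 0 ≤ c) :
    ∃ C, 0 ≤ C ∧ ∀ x ∈ Icc (0 : ℝ) c, (1 + x) ^ n ≤ 1 + n * x + C * x ^ 2 := by
  induction n with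
  | zero => exact ⟨0, le_rfl, fun x _ => by simp⟩
  | succ m ih =>
    obtain ⟨C, hC, h⟩ := ih
    refine ⟨m + C + C * c, by positivity, fun x hx => ?_⟩
    have h1 := mul_le_mul_of_nonneg_right (h x hx) (by linarith [hx.1] : 0 ≤ 1 + x)
    have h2 : C * x ^ 2 * x ≤ C * x ^ 2 * c :=
      mul_le_mul_of_nonneg_left hx.2 (mul_nonneg hC (sq_nonneg x))
    rw [pow_succ]
    push_cast
    nlinarith

theorem smul_gauge_mem {K : Conv n} (h0 : (K : Set (E n)) ∈ 𝓝 0)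
    (θ : Metric.sphere (0 : E n) 1) : (gauge (K : Set (E n)) (θ : E n))⁻¹ • (θ : E n) ∈ K := by
  have hθ := gauge_pos_of_sphere h0 K.isBounded θ
  have := (gauge_le_one_iff_mem_closure (x := (gauge (K : Set (E n)) (θ : E n))⁻¹ • (θ : E n))
    K.convex h0).1 (by
      rw [gauge_smul_of_nonneg (inv_nonneg.2 hθ.le), smul_eq_mul, inv_mul_cancel₀ hθ.ne'])
  rwa [K.isClosed.closure_eq] at this

theorem le_inv_gauge {K : Conv n} (h0 : (K : Set (E n)) ∈ 𝓝 0) {θ : Metric.sphere (0 : E n) 1}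
    {a : ℝ} (ha : 0 ≤ a) (h : a • (θ : E n) ∈ K) : a ≤ (gauge (K : Set (E n)) (θ : E n))⁻¹ := by
  have hθ := gauge_pos_of_sphere h0 K.isBounded θ
  have := gauge_le_one_of_mem (s := (K : Set (E n))) h
  rw [gauge_smul_of_nonneg ha, smul_eq_mul] at this
  rwa [← one_div, le_div_iff₀ hθ]

/-- A substitute for the Brunn-Minkowski inequality along `u + s w`, up to second order in `s`. -/
theorem vol_add_smul_almost_concave (hn : n ≠ 0) {u w : Conv n} (hu : (u : Set (E n)) ∈ 𝓝 0)
    (hw : (0 : E n) ∈ w) : ∃ C, 0 ≤ C ∧ ∀ s ∈ Icc (0 : ℝ) 1, ∀ l ∈ Icc (0 : ℝ) 1,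
      l * (vol (u + s • w) - vol u) - C * l * s ^ 2 ≤ vol (u + (l * s) • w) - vol u := by
  -- `u` contains a ball about `0` and `w` is bounded, so `w ⊆ c u`. Then `u + s w ⊆ (1 + c s) u`,
  -- which bounds the growth of the radial function `g`.
  obtain ⟨c, hc, hcw⟩ : ∃ c : ℝ, 0 ≤ c ∧ ∀ x ∈ w, ∃ y ∈ u, x = c • y := by
    obtain ⟨r, hr, hru⟩ := Metric.mem_nhds_iff.1 hu
    obtain ⟨R, hR, h⟩ := w.isBounded.exists_pos_norm_lt
    refine ⟨R / r, by positivity, fun x hx => ⟨(R / r)⁻¹ • x, hru ?_, ?_⟩⟩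
    · rw [mem_ball_zero_iff, norm_smul, norm_inv, Real.norm_of_nonneg (by positivity), inv_div,
        div_mul_eq_mul_div, div_lt_iff₀ hR]
      exact mul_lt_mul_of_pos_left (h x hx) hr
    · rw [smul_inv_smul₀ (by positivity)]
  have hsub : ∀ s : ℝ, (u : Set (E n)) ⊆ (u + s • w : Conv n) := fun s x hx =>
    mem_add_iff.2 ⟨x, hx, 0, mem_smul_iff.2 ⟨0, hw, smul_zero _⟩, add_zero _⟩
  have hnhds : ∀ s : ℝ, ((u + s • w : Conv n) : Set (E n)) ∈ 𝓝 0 := fun s =>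
    mem_of_superset hu (hsub s)
  set g : ℝ → Metric.sphere (0 : E n) 1 → ℝ :=
    fun s θ => (gauge ((u + s • w : Conv n) : Set (E n)) (θ : E n))⁻¹
  have hgpos : ∀ s θ, 0 < g s θ := fun s θ =>
    inv_pos.2 (gauge_pos_of_sphere (hnhds s) (ConvexBody.isBounded _) θ)
  have hvol : ∀ s, vol (u + s • w) =
      ∫ θ, g s θ ^ n / (n : ℝ) ∂(volume : Measure (E n)).toSphere :=
    fun s => vol_eq_integral_gauge hn (hnhds s)
  have hint : ∀ s, Integrable (fun θ => g s θ ^ n / (n : ℝ)) (volume : Measure (E n)).toSphere :=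
    fun s => integrable_polar (continuous_polar (ConvexBody.convex _) (hnhds s)
      (ConvexBody.isBounded _))
  have hz : u + (0 : ℝ) • w = u := by rw [zero_smul_body, add_zero]
  have hg1 : ∀ s θ, 0 ≤ s → g 0 θ ≤ g s θ := fun s θ hs => by
    refine le_inv_gauge (hnhds s) (hgpos 0 θ).le (hsub s ?_)
    have := smul_gauge_mem (hnhds 0) θ
    change g 0 θ • (θ : E n) ∈ _ at this
    rwa [hz] at this
  have hg2 : ∀ s θ, 0 ≤ s → g s θ ≤ (1 + c * s) * g 0 θ := fun s θ hs => by
    have h1 : (0 : ℝ) < 1 + c * s := by positivity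
    have hm := smul_gauge_mem (hnhds s) θ
    change g s θ • (θ : E n) ∈ _ at hm
    obtain ⟨a, ha, b, hb, hab⟩ := mem_add_iff.1 hm
    obtain ⟨y, hy, rfl⟩ := mem_smul_iff.1 hb
    obtain ⟨z, hz', rfl⟩ := hcw y hy
    have h2 : ((1 + c * s)⁻¹ * g s θ) • (θ : E n) ∈ u + (0 : ℝ) • w := by
      rw [hz, mul_smul, ← hab]
      have := u.convex ha hz' (a := (1 + c * s)⁻¹) (b := (1 + c * s)⁻¹ * (c * s))
        (by positivity) (by positivity) (by field_simp)
      rwa [show (1 + c * s)⁻¹ • (a + s • c • z) =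
        (1 + c * s)⁻¹ • a + ((1 + c * s)⁻¹ * (c * s)) • z by module]
    have h3 := le_inv_gauge (hnhds 0) (by have := hgpos s θ; positivity) h2
    rw [inv_mul_le_iff₀ h1] at h3
    exact h3
  -- Concavity of the radial function in `s`: the convex combination of boundary points of `u` and
  -- of `u + s w` on the same ray lies in `u + l s w`.
  have hg3 : ∀ s θ, 0 ≤ s → ∀ l ∈ Icc (0 : ℝ) 1, (1 - l) * g 0 θ + l * g s θ ≤ g (l * s) θ := by
    intro s θ hs l hl
    have h0 := smul_gauge_mem (hnhds 0) θ
    have h1 := smul_gauge_mem (hnhds s) θ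
    change g 0 θ • (θ : E n) ∈ _ at h0
    change g s θ • (θ : E n) ∈ _ at h1
    rw [hz] at h0
    have p0 := hgpos 0 θ
    have p1 := hgpos s θ
    have hl' : 0 ≤ 1 - l := sub_nonneg.2 hl.2
    refine le_inv_gauge (hnhds _)
      (add_nonneg (mul_nonneg hl' p0.le) (mul_nonneg hl.1 p1.le)) ?_
    obtain ⟨a, ha, b, hb, hab⟩ := mem_add_iff.1 h1
    obtain ⟨y, hy, rfl⟩ := mem_smul_iff.1 hb
    rw [add_smul, mul_smul (1 - l), mul_smul l (g s θ), ← hab]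
    refine mem_add_iff.2 ⟨(1 - l) • g 0 θ • (θ : E n) + l • a,
      u.convex h0 ha hl' hl.1 (by ring), _, mem_smul_iff.2 ⟨y, hy, rfl⟩, ?_⟩
    module
  obtain ⟨C, hC, hpow⟩ := exists_one_add_pow_le n hc
  refine ⟨C * c ^ 2 * vol u, mul_nonneg (by positivity) (vol_nonneg u), fun s hs l hl => ?_⟩
  -- With `g s = g 0 (1 + x)` and `0 ≤ x ≤ c s`, concavity gives `g (l s) ≥ g 0 (1 + l x)`.
  -- Bernoulli bounds `(1 + l x) ^ n` below by `1 + n l x`, while `(1 + x) ^ n` exceeds `1 + n x` by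
  -- at most `C x²`. Integration over the sphere yields the claim.
  have hpt : ∀ θ, l * (g s θ ^ n / (n : ℝ) - g 0 θ ^ n / (n : ℝ)) -
      C * c ^ 2 * l * s ^ 2 * (g 0 θ ^ n / (n : ℝ)) ≤
        g (l * s) θ ^ n / (n : ℝ) - g 0 θ ^ n / (n : ℝ) := by
    intro θ
    have p0 := hgpos 0 θ
    set x := g s θ / g 0 θ - 1 with hx
    have hgs : g s θ = g 0 θ * (1 + x) := by rw [hx]; field_simp; ring
    have hx0 : 0 ≤ x := by
      rw [hx, sub_nonneg, le_div_iff₀ p0, one_mul]; exact hg1 s θ hs.1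
    have hx1 : x ≤ c * s := by
      rw [hx, sub_le_iff_le_add', div_le_iff₀ p0]; exact hg2 s θ hs.1
    have hx2 : x ≤ c := hx1.trans (mul_le_of_le_one_right hc hs.2)
    have h1 := hpow x ⟨hx0, hx2⟩
    have h2 : 1 + n * (l * x) ≤ (1 + l * x) ^ n :=
      one_add_mul_le_pow (by have := mul_nonneg hl.1 hx0; linarith) n
    have h3 : (g 0 θ * (1 + l * x)) ^ n ≤ g (l * s) θ ^ n := by
      have := mul_nonneg hl.1 hx0
      refine pow_le_pow_left₀ (by positivity) ?_ n
      refine le_trans (le_of_eq ?_) (hg3 s θ hs.1 l hl)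
      rw [hgs]; ring
    have h4 : x ^ 2 ≤ c ^ 2 * s ^ 2 := by rw [← mul_pow]; exact pow_le_pow_left₀ hx0 hx1 2
    have h5 : l * ((1 + x) ^ n - 1) - C * c ^ 2 * l * s ^ 2 ≤ (1 + l * x) ^ n - 1 := by
      have h6 : l * (1 + x) ^ n ≤ l * (1 + n * x + C * (c ^ 2 * s ^ 2)) := by
        refine mul_le_mul_of_nonneg_left (h1.trans ?_) hl.1
        have := mul_le_mul_of_nonneg_left h4 hC
        linarith
      nlinarith
    have hn' : (0 : ℝ) < n := by exact_mod_cast Nat.pos_of_ne_zero hn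
    have h7 := mul_le_mul_of_nonneg_left h5 (by positivity : 0 ≤ g 0 θ ^ n / (n : ℝ))
    have h8 : (g 0 θ * (1 + l * x)) ^ n / (n : ℝ) ≤ g (l * s) θ ^ n / (n : ℝ) := by gcongr
    rw [mul_pow] at h8
    rw [hgs, mul_pow]
    calc _ = g 0 θ ^ n / (n : ℝ) * (l * ((1 + x) ^ n - 1) - C * c ^ 2 * l * s ^ 2) := by ring
      _ ≤ _ := h7
      _ = g 0 θ ^ n * (1 + l * x) ^ n / (n : ℝ) - g 0 θ ^ n / (n : ℝ) := by ring
      _ ≤ _ := by linarith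
  have i1 : Integrable (fun θ => l * (g s θ ^ n / (n : ℝ) - g 0 θ ^ n / (n : ℝ)))
      (volume : Measure (E n)).toSphere := ((hint s).sub (hint 0)).const_mul l
  have i2 : Integrable (fun θ => C * c ^ 2 * l * s ^ 2 * (g 0 θ ^ n / (n : ℝ)))
      (volume : Measure (E n)).toSphere := (hint 0).const_mul _
  have hI := integral_mono (i1.sub i2) ((hint (l * s)).sub (hint 0)) hpt
  simp only [Pi.sub_apply] at hI
  rw [integral_sub i1 i2, integral_const_mul, integral_const_mul,
    integral_sub (hint s) (hint 0), integral_sub (hint (l * s)) (hint 0), ← hvol, ← hvol, ← hvol,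
    hz] at hI
  linarith

/-- A bounded function that is nonincreasing up to a linear error has a limit at `0+`. -/
theorem exists_tendsto_of_almost_antitone {g : ℝ → ℝ} {C M : ℝ} (hC : 0 ≤ C)
    (hM : ∀ s ∈ Ioc (0 : ℝ) 1, g s ≤ M)
    (h : ∀ s ∈ Ioc (0 : ℝ) 1, ∀ t ∈ Ioc (0 : ℝ) s, g s - C * s ≤ g t) :
    ∃ L, Tendsto g (𝓝[>] 0) (𝓝 L) := by
  -- The limit is the supremum of `g s - C s`: any value close to it bounds `g` from below at all
  -- smaller arguments, and `g t ≤ sup + C t`.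
  set A := (fun s => g s - C * s) '' Ioc (0 : ℝ) 1
  have hA : BddAbove A := by
    refine ⟨M, ?_⟩
    rintro _ ⟨s, hs, rfl⟩
    have := hM s hs
    have := mul_nonneg hC hs.1.le
    simp only; linarith
  have hAne : A.Nonempty := (nonempty_Ioc.2 zero_lt_one).image _
  refine ⟨sSup A, tendsto_order.2 ⟨fun a ha => ?_, fun b hb => ?_⟩⟩
  · obtain ⟨_, ⟨s, hs, rfl⟩, has⟩ := exists_lt_of_lt_csSup hAne ha
    filter_upwards [Ioc_mem_nhdsGT hs.1] with t ht
    exact has.trans_le (h s hs t ht)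
  · have hlim : Tendsto (fun t => sSup A + C * t) (𝓝[>] 0) (𝓝 (sSup A)) :=
      (Continuous.tendsto' (by fun_prop) _ _ (by simp)).mono_left nhdsWithin_le_nhds
    filter_upwards [Ioc_mem_nhdsGT zero_lt_one, hlim.eventually_lt_const hb] with t ht hlt
    have := le_csSup hA ⟨t, ht, rfl⟩
    simp only at this
    linarith

theorem differentiableWithinAt_vol_add_of_mem_nhds (hn : n ≠ 0) {u w : Conv n}
    (hu : (u : Set (E n)) ∈ 𝓝 0) (hw : (0 : E n) ∈ w) :
    DifferentiableWithinAt ℝ (fun ρ : ℝ => vol (u + ρ • w)) (Ici 0) 0 := by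
  obtain ⟨C, hC, h⟩ := vol_add_smul_almost_concave hn hu hw
  obtain ⟨M, hM, hV⟩ := exists_vol_le_add n (supNorm u)
  set K := max (supNorm w) 1
  have hK : 0 < K := zero_lt_one.trans_le (le_max_right _ _)
  have hz : u + (0 : ℝ) • w = u := by rw [zero_smul_body, add_zero]
  obtain ⟨L, hL⟩ : ∃ L, Tendsto (fun s => (vol (u + s • w) - vol u) / s) (𝓝[>] 0) (𝓝 L) := by
    have hanti : ∀ s ∈ Ioc (0 : ℝ) 1, ∀ t ∈ Ioc (0 : ℝ) s,
        (vol (u + s • w) - vol u) / s - C * s ≤ (vol (u + t • w) - vol u) / t := by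
      intro s hs t ht
      have := h s ⟨hs.1.le, hs.2⟩ (t / s)
        ⟨div_nonneg ht.1.le hs.1.le, (div_le_one hs.1).2 ht.2⟩
      rw [div_mul_cancel₀ _ hs.1.ne'] at this
      rw [le_div_iff₀ ht.1]
      refine le_trans (le_of_eq ?_) this
      have := hs.1.ne'
      field_simp
    have hbd : ∀ s ∈ Ioc (0 : ℝ) (1 / K), (vol (u + s • w) - vol u) / s ≤ M * K := by
      intro s hs
      rw [div_le_iff₀ hs.1]
      have hsK : s * K ≤ 1 := (le_div_iff₀ hK).1 hs.2
      have := hV (u + s • w) u le_rfl (s * K) ⟨mul_nonneg hs.1.le hK.le, hsK⟩ fun p => by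
        rw [supportFun_add, supportFun_smul hs.1.le, mul_assoc]
        gcongr
        · exact hs.1.le
        · exact (le_abs_self _).trans ((abs_supportFun_le w p).trans (by
            gcongr; exact le_max_left _ _))
      linarith
    have hK1 : 1 / K ≤ 1 := (div_le_one hK).2 (le_max_right _ _)
    have hKpos : 0 < 1 / K := by positivity
    refine exists_tendsto_of_almost_antitone (M := M * K + C) hC (fun s hs => ?_) hanti
    -- The Lipschitz bound covers only `s ≤ 1 / K`; larger `s` are reduced to this range by almost
    -- monotonicity.
    have hmin : min s (1 / K) ∈ Ioc (0 : ℝ) s := ⟨lt_min hs.1 hKpos, min_le_left _ _⟩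
    have h1 := hanti s hs _ hmin
    have h2 := hbd _ ⟨lt_min hs.1 hKpos, min_le_right _ _⟩
    have h3 : C * s ≤ C := mul_le_of_le_one_right hC hs.2
    linarith
  refine HasDerivWithinAt.differentiableWithinAt (f' := L) ?_
  rw [hasDerivWithinAt_iff_tendsto_slope, Ici_sdiff_left]
  refine hL.congr fun s => ?_
  rw [slope_def_field, hz, sub_zero]

/-- The limit in Minkowski's formula for the first mixed volume exists. -/
theorem differentiableWithinAt_vol_add (hn : n ≠ 0) (u w : Conv n) :
    DifferentiableWithinAt ℝ (fun ρ : ℝ => vol (u + ρ • w)) (Ici 0) 0 := by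
  by_cases hu : (interior (u : Set (E n))).Nonempty
  · obtain ⟨x, hx⟩ := hu
    obtain ⟨y, hy⟩ := w.nonempty
    have := differentiableWithinAt_vol_add_of_mem_nhds hn (u := u + point (-x))
      (w := w + point (-y)) ?_ (mem_add_point_neg.2 (by rwa [zero_add]))
    · simpa only [vol_add_add_point] using this
    · have hc : Continuous fun z : E n => z + x := by fun_prop
      have h1 := hc.tendsto' 0 x (zero_add x) (mem_interior_iff_mem_nhds.1 hx)
      exact mem_of_superset h1 fun z hz => mem_add_point_neg.2 hz
  · refine differentiableWithinAt_vol_add_of_vol_eq_zero ?_ w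
    rw [not_nonempty_iff_eq_empty] at hu
    rw [vol, ← measure_congr (interior_ae_eq_of_null_frontier
      (u.convex.addHaar_frontier volume)), hu]
    simp

end Polar

/-! ### Operator exponentials and their determinants -/

section Exponential

theorem exp_smul_adjoint (A : E n →L[ℝ] E n) (τ : ℝ) :
    NormedSpace.exp (τ • ContinuousLinearMap.adjoint A) =
      ContinuousLinearMap.adjoint (NormedSpace.exp (τ • A)) := by
  rw [← ContinuousLinearMap.star_eq_adjoint, ← ContinuousLinearMap.star_eq_adjoint,
    NormedSpace.star_exp]
  congr 1
  simp only [ContinuousLinearMap.star_eq_adjoint]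
  simp

theorem exp_add_smul (B : E n →L[ℝ] E n) (σ τ : ℝ) :
    NormedSpace.exp ((σ + τ) • B) = NormedSpace.exp (σ • B) * NormedSpace.exp (τ • B) := by
  let _ : NormedAlgebra ℚ (E n →L[ℝ] E n) := NormedAlgebra.restrictScalars ℚ ℝ _
  rw [show (σ + τ) • B = σ • B + τ • B by ext x : 1; simp [add_smul]]
  refine NormedSpace.exp_add_of_commute ?_
  ext x : 1
  change σ • B (τ • B x) = τ • B (σ • B x)
  rw [map_smul, map_smul, smul_comm]

theorem hasDerivAt_exp_smul (B : E n →L[ℝ] E n) (τ : ℝ) :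
    HasDerivAt (fun t : ℝ => NormedSpace.exp (t • B)) (NormedSpace.exp (τ • B) * B) τ :=
  hasDerivAt_exp_smul_const B τ

theorem continuous_exp_smul (B : E n →L[ℝ] E n) :
    Continuous fun t : ℝ => NormedSpace.exp (t • B) :=
  continuous_iff_continuousAt.2 fun τ => (hasDerivAt_exp_smul B τ).continuousAt

theorem zero_smul_operator (B : E n →L[ℝ] E n) : (0 : ℝ) • B = 0 := by
  ext x : 1; simp

theorem exp_zero_smul (B : E n →L[ℝ] E n) : NormedSpace.exp ((0 : ℝ) • B) = 1 := by
  rw [zero_smul_operator, NormedSpace.exp_zero]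

theorem differentiable_det : Differentiable ℝ fun L : E n →L[ℝ] E n => L.det := by
  set b := (EuclideanSpace.basisFun (Fin n) ℝ).toBasis
  have : (fun L : E n →L[ℝ] E n => L.det) = fun L => ∑ σ : Equiv.Perm (Fin n),
      (Equiv.Perm.sign σ : ℤ) • ∏ i, (L (b i)) (σ i) := by
    funext L
    rw [ContinuousLinearMap.det, ← LinearMap.det_toMatrix b, Matrix.det_apply]
    simp [b, LinearMap.toMatrix_apply, Units.smul_def]
  rw [this]
  have hent : ∀ (x : E n) (j : Fin n), Differentiable ℝ fun L : E n →L[ℝ] E n => (L x) j :=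
    fun x j => ((EuclideanSpace.proj (𝕜 := ℝ) j).comp
      (ContinuousLinearMap.apply ℝ (E n) x)).differentiable
  refine Differentiable.fun_sum fun σ _ => ?_
  refine Differentiable.const_smul (c := (Equiv.Perm.sign σ : ℤ)) ?_
  exact fun L => (HasFDerivAt.finsetProd fun i _ =>
    (hent (b i) (σ i) L).hasFDerivAt).differentiableAt

theorem hasDerivAt_det_one_add_smul (A : E n →L[ℝ] E n) :
    HasDerivAt (fun τ : ℝ => (1 + τ • A).det) (LinearMap.trace ℝ (E n) (A : E n →ₗ[ℝ] E n)) 0 := by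
  set b := (EuclideanSpace.basisFun (Fin n) ℝ).toBasis
  set M := LinearMap.toMatrix b b (A : E n →ₗ[ℝ] E n)
  set p := (1 + (Polynomial.X : Polynomial ℝ) • M.map Polynomial.C).det.divX.divX
  have h : ∀ τ : ℝ, (1 + τ • A).det = 1 + M.trace * τ + p.eval τ * τ ^ 2 := by
    intro τ
    rw [ContinuousLinearMap.det, ← LinearMap.det_toMatrix b, ← Matrix.det_one_add_smul]
    congr 1
    rw [show ((1 + τ • A : E n →L[ℝ] E n) : E n →ₗ[ℝ] E n) =
      LinearMap.id + τ • (A : E n →ₗ[ℝ] E n) from rfl, _root_.map_add, LinearMap.toMatrix_id,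
      map_smul]
  rw [funext h, LinearMap.trace_eq_matrix_trace ℝ b]
  have h1 := (((hasDerivAt_id (0 : ℝ)).const_mul M.trace).const_add 1).add
    ((p.hasDerivAt 0).mul ((hasDerivAt_id (0 : ℝ)).pow 2))
  convert! h1 using 1
  simp [M]

/-- The curves `exp (τ A)` and `1 + τ A` have the same value and tangent at `τ = 0`, so the
differentiable function `det` has the same derivative along both. Along the second it is a
polynomial in `τ` with linear coefficient `tr A`. -/
theorem hasDerivAt_det_exp_smul (A : E n →L[ℝ] E n) :
    HasDerivAt (fun τ : ℝ => (NormedSpace.exp (τ • A)).det)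
      (LinearMap.trace ℝ (E n) (A : E n →ₗ[ℝ] E n)) 0 := by
  set D := fderiv ℝ (fun L : E n →L[ℝ] E n => L.det) 1
  have hD : HasFDerivAt (fun L : E n →L[ℝ] E n => L.det) D 1 :=
    (differentiable_det 1).hasFDerivAt
  have h1 : HasDerivAt (fun τ : ℝ => (NormedSpace.exp (τ • A)).det) (D A) 0 := by
    have := hasDerivAt_exp_smul A 0
    rw [exp_zero_smul, one_mul] at this
    exact HasFDerivAt.comp_hasDerivAt_of_eq 0 hD this (exp_zero_smul A).symm
  have h2 : HasDerivAt (fun τ : ℝ => (1 + τ • A).det) (D A) 0 := by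
    have := ((hasDerivAt_id (0 : ℝ)).smul_const A).const_add 1
    rw [one_smul] at this
    exact HasFDerivAt.comp_hasDerivAt_of_eq 0 hD this (by
      rw [zero_smul_operator, add_zero])
  rwa [h2.unique (hasDerivAt_det_one_add_smul A)] at h1

theorem hasDerivAt_abs_det_exp_smul (A : E n →L[ℝ] E n) :
    HasDerivAt (fun τ : ℝ => |(NormedSpace.exp (τ • A)).det|)
      (LinearMap.trace ℝ (E n) (A : E n →ₗ[ℝ] E n)) 0 := by
  have h := hasDerivAt_det_exp_smul A
  refine h.congr_of_eventuallyEq ?_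
  have h1 : (0 : ℝ) < (NormedSpace.exp ((0 : ℝ) • A)).det := by
    rw [exp_zero_smul, ContinuousLinearMap.det, ContinuousLinearMap.toLinearMap_one]
    simp
  filter_upwards [h.continuousAt.eventually_const_lt h1] with τ hτ
  exact abs_of_pos hτ

end Exponential

/-! ### The differential equation for the volume along a solution -/

section VolumeEvolution

theorem continuous_supportFun : Continuous fun q : Conv n × E n => supportFun q.1 q.2 := by
  refine continuous_iff_continuousAt.2 fun q₀ => ?_
  rw [ContinuousAt, tendsto_iff_norm_sub_tendsto_zero]
  refine squeeze_zero (fun _ => norm_nonneg _)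
    (g := fun q => dist q.1 q₀.1 * ‖q.2‖ + supNorm q₀.1 * ‖q.2 - q₀.2‖) (fun q => ?_) ?_
  · have h1 := supportFun_sub_le_dist q.1 q₀.1 q.2
    have h2 := supportFun_sub_le q₀.1 q.2 q₀.2
    exact (abs_sub_le _ (supportFun q₀.1 q.2) _).trans (add_le_add h1 h2)
  · exact Continuous.tendsto' (by fun_prop) _ _ (by simp)

/-- The integral equation with coefficients `a(s) = φ(V[u(s)])` and `b(s) = F(V[u(s)], u(s))` that
are continuous on the whole line. -/
structure IsMildSolution (A : E n →L[ℝ] E n) (a : ℝ → ℝ) (b : ℝ → Conv n) (u₀ : Conv n)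
    (u : ℝ → Conv n) : Prop where
  cont_a : Continuous a
  cont_b : Continuous b
  cont_u : Continuous u
  eq : ∀ t, 0 ≤ t → ∀ p : E n, supportFun (u t) p =
    supportFun u₀ (NormedSpace.exp ((∫ s in (0 : ℝ)..t, a s) • ContinuousLinearMap.adjoint A) p) +
    ∫ s in (0 : ℝ)..t, supportFun (b s)
      (NormedSpace.exp ((∫ τ in s..t, a τ) • ContinuousLinearMap.adjoint A) p)

variable {A : E n →L[ℝ] E n} {a : ℝ → ℝ} {b : ℝ → Conv n} {u₀ : Conv n} {u : ℝ → Conv n}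

theorem continuous_integral₂ (ha : Continuous a) :
    Continuous fun q : ℝ × ℝ => ∫ τ in q.1..q.2, a τ := by
  have h : (fun q : ℝ × ℝ => ∫ τ in q.1..q.2, a τ) =
      fun q => (∫ τ in (0 : ℝ)..q.2, a τ) - ∫ τ in (0 : ℝ)..q.1, a τ := by
    funext q
    rw [intervalIntegral.integral_interval_sub_left (ha.intervalIntegrable _ _)
      (ha.intervalIntegrable _ _)]
  have hc : Continuous fun t => ∫ τ in (0 : ℝ)..t, a τ :=
    intervalIntegral.continuous_primitive (fun _ _ => ha.intervalIntegrable _ _) 0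
  rw [h]
  fun_prop

theorem continuous_exp_integral (ha : Continuous a) (B : E n →L[ℝ] E n) :
    Continuous fun q : ℝ × ℝ => NormedSpace.exp ((∫ τ in q.1..q.2, a τ) • B) :=
  (continuous_exp_smul B).comp (continuous_integral₂ ha)

theorem continuous_integrand (ha : Continuous a) (hb : Continuous b) (B : E n →L[ℝ] E n) (t : ℝ)
    (p : E n) : Continuous fun s =>
      supportFun (b s) (NormedSpace.exp ((∫ τ in s..t, a τ) • B) p) := by
  refine continuous_supportFun.comp (hb.prodMk ?_)
  have := (continuous_exp_integral ha B).comp (continuous_id.prodMk (continuous_const (y := t)))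
  exact this.clm_apply continuous_const

/-- The integral equation restarted at time `t`. -/
theorem IsMildSolution.restart (h : IsMildSolution A a b u₀ u) {t t' : ℝ} (ht : 0 ≤ t)
    (htt' : t ≤ t') (p : E n) : supportFun (u t') p =
      supportFun (u t)
        (NormedSpace.exp ((∫ s in t..t', a s) • ContinuousLinearMap.adjoint A) p) +
      ∫ s in t..t', supportFun (b s)
        (NormedSpace.exp ((∫ τ in s..t', a τ) • ContinuousLinearMap.adjoint A) p) := by
  set B := ContinuousLinearMap.adjoint A
  have hi : ∀ x y, IntervalIntegrable a volume x y := fun x y => h.cont_a.intervalIntegrable _ _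
  have hcomp : ∀ s, NormedSpace.exp ((∫ τ in s..t', a τ) • B) p =
      NormedSpace.exp ((∫ τ in s..t, a τ) • B) (NormedSpace.exp ((∫ τ in t..t', a τ) • B) p) := by
    intro s
    rw [← intervalIntegral.integral_add_adjacent_intervals (hi s t) (hi t t'), exp_add_smul]
    rfl
  have hc := continuous_integrand h.cont_a h.cont_b B t' p
  rw [h.eq t' (ht.trans htt') p, h.eq t ht, ← intervalIntegral.integral_add_adjacent_intervals
    (hc.intervalIntegrable 0 t) (hc.intervalIntegrable t t'), ← add_assoc, hcomp 0]
  congr 2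
  exact intervalIntegral.integral_congr fun s _ => by simp only [hcomp s, B]

/-- To first order, `u(t')` is the image of `u(t) + (t' - t) b(t)`. -/
theorem IsMildSolution.approx (h : IsMildSolution A a b u₀ u) {t : ℝ} (ht : 0 ≤ t) {ε : ℝ}
    (hε : 0 < ε) : ∀ᶠ t' in 𝓝[≥] t, ∀ p : E n,
      |supportFun (map (NormedSpace.exp ((∫ s in t..t', a s) • A)) (u t + (t' - t) • b t)) p -
        supportFun (u t') p| ≤ (ε * (t' - t)) * ‖p‖ := by
  set B := ContinuousLinearMap.adjoint A
  set X : ℝ × ℝ → E n →L[ℝ] E n := fun q => NormedSpace.exp ((∫ τ in q.1..q.2, a τ) • B)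
  have hX : Continuous X := continuous_exp_integral h.cont_a B
  -- `Ψ (s, t') * ‖p‖` bounds the error of replacing `b s` and `X (s, t')` in the integrand by `b t`
  -- and `X (t, t')`. It is continuous and vanishes at `(t, t)`, which makes the estimate uniform in
  -- `p`.
  set Ψ : ℝ × ℝ → ℝ := fun q => dist (b q.1) (b t) * ‖X q‖ + supNorm (b t) * ‖X q - X (t, q.2)‖
  have hΨ : Continuous Ψ := by
    have h1 : Continuous fun q : ℝ × ℝ => X (t, q.2) := hX.comp (by fun_prop)
    have h2 := h.cont_b
    fun_prop
  have hΨ0 : Ψ (t, t) < ε := by simpa [Ψ] using hε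
  obtain ⟨δ, hδ, hball⟩ := Metric.eventually_nhds_iff.1
    (hΨ.continuousAt.eventually_lt_const hΨ0)
  filter_upwards [Ico_mem_nhdsGE (show t < t + δ by linarith)] with t' ht' p
  have hc := continuous_integrand h.cont_a h.cont_b B t' p
  rw [h.restart ht ht'.1, supportFun_map, ← exp_smul_adjoint, supportFun_add,
    supportFun_smul (sub_nonneg.2 ht'.1), add_sub_add_left_eq_sub, abs_sub_comm]
  have hconst : (t' - t) * supportFun (b t) (X (t, t') p) =
      ∫ _ in t..t', supportFun (b t) (X (t, t') p) := by
    rw [intervalIntegral.integral_const, smul_eq_mul]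
  change |_ - (t' - t) * supportFun (b t) (X (t, t') p)| ≤ _
  rw [hconst, ← intervalIntegral.integral_sub (hc.intervalIntegrable _ _)
    (continuous_const.intervalIntegrable _ _)]
  have := intervalIntegral.norm_integral_le_of_norm_le_const (a := t) (b := t') (C := ε * ‖p‖)
    (f := fun s => supportFun (b s) (X (s, t') p) - supportFun (b t) (X (t, t') p)) ?_
  · rw [abs_of_nonneg (sub_nonneg.2 ht'.1)] at this
    refine this.trans (le_of_eq (by ring))
  · intro s hs
    rw [uIoc_of_le ht'.1] at hs
    have h1 := supportFun_sub_le_dist (b s) (b t) (X (s, t') p)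
    have h2 := supportFun_sub_le (b t) (X (s, t') p) (X (t, t') p)
    have h3 : ‖X (s, t') p‖ ≤ ‖X (s, t')‖ * ‖p‖ := ContinuousLinearMap.le_opNorm _ _
    have h4 : ‖X (s, t') p - X (t, t') p‖ ≤ ‖X (s, t') - X (t, t')‖ * ‖p‖ := by
      rw [← sub_apply]; exact ContinuousLinearMap.le_opNorm _ _
    have h5 : Ψ (s, t') < ε := by
      refine hball ?_
      rw [Prod.dist_eq, max_lt_iff, Real.dist_eq, Real.dist_eq,
        abs_of_nonneg (sub_nonneg.2 hs.1.le), abs_of_nonneg (sub_nonneg.2 ht'.1)]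
      constructor <;> linarith [hs.2, ht'.2]
    calc ‖supportFun (b s) (X (s, t') p) - supportFun (b t) (X (t, t') p)‖
        ≤ dist (b s) (b t) * ‖X (s, t') p‖ + supNorm (b t) * ‖X (s, t') p - X (t, t') p‖ :=
          (abs_sub_le _ (supportFun (b t) (X (s, t') p)) _).trans (add_le_add h1 h2)
      _ ≤ dist (b s) (b t) * (‖X (s, t')‖ * ‖p‖) +
          supNorm (b t) * (‖X (s, t') - X (t, t')‖ * ‖p‖) := by
          gcongr; exact supNorm_nonneg _
      _ = Ψ (s, t') * ‖p‖ := by simp only [Ψ]; ring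
      _ ≤ ε * ‖p‖ := by gcongr

/-- The evolution of the volume. -/
theorem IsMildSolution.hasDerivWithinAt_vol (hn : n ≠ 0) (h : IsMildSolution A a b u₀ u) {t : ℝ}
    (ht : 0 ≤ t) : HasDerivWithinAt (fun s => vol (u s))
      (LinearMap.trace ℝ (E n) (A : E n →ₗ[ℝ] E n) * a t * vol (u t) +
        n * mixedVol₁ (u t) (b t)) (Ici t) t := by
  set k : ℝ → ℝ := fun t' =>
    vol (map (NormedSpace.exp ((∫ s in t..t', a s) • A)) (u t + (t' - t) • b t)) with hk_def
  have hkt : k t = vol (u t) := by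
    simp only [hk_def, intervalIntegral.integral_same, sub_self, zero_smul_body, add_zero, vol_map,
      exp_zero_smul]
    rw [ContinuousLinearMap.det, ContinuousLinearMap.toLinearMap_one]
    simp
  have hk : HasDerivWithinAt k (LinearMap.trace ℝ (E n) (A : E n →ₗ[ℝ] E n) * a t * vol (u t) +
      n * mixedVol₁ (u t) (b t)) (Ici t) t := by
    -- Differentiability ensures that the `derivWithin` in `mixedVol₁` is a true derivative rather
    -- than a default value.
    have h1 : HasDerivWithinAt (fun ρ : ℝ => vol (u t + ρ • b t))
        (n * mixedVol₁ (u t) (b t)) (Ici 0) 0 := by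
      have hn' : (n : ℝ) ≠ 0 := Nat.cast_ne_zero.2 hn
      rw [mixedVol₁, ← mul_assoc, mul_one_div_cancel hn', one_mul]
      exact (differentiableWithinAt_vol_add hn (u t) (b t)).hasDerivWithinAt
    have h2 : HasDerivWithinAt (fun t' => vol (u t + (t' - t) • b t))
        (n * mixedVol₁ (u t) (b t)) (Ici t) t := by
      have := HasDerivWithinAt.comp_of_eq t h1
        ((hasDerivAt_id t).sub_const t).hasDerivWithinAt (s := Ici t)
        (fun x hx => sub_nonneg.2 (mem_Ici.1 hx)) (sub_self t).symm
      rwa [mul_one] at this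
    have h3 : HasDerivAt (fun t' => ∫ s in t..t', a s) (a t) t :=
      intervalIntegral.integral_hasDerivAt_right (h.cont_a.intervalIntegrable _ _)
        (h.cont_a.stronglyMeasurableAtFilter _ _) h.cont_a.continuousAt
    have h4 := HasDerivAt.comp_of_eq t (hasDerivAt_abs_det_exp_smul A) h3
      intervalIntegral.integral_same.symm
    have h5 := h4.hasDerivWithinAt.mul h2 (s := Ici t)
    simp only [Function.comp_def, intervalIntegral.integral_same, exp_zero_smul, sub_self,
      zero_smul_body, add_zero] at h5
    have hk' : k = fun t' => |(NormedSpace.exp ((∫ s in t..t', a s) • A)).det| *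
        vol (u t + (t' - t) • b t) := funext fun t' => vol_map _ _
    rw [hk']
    refine h5.congr_deriv ?_
    rw [ContinuousLinearMap.det, ContinuousLinearMap.toLinearMap_one]
    simp
  -- The two bodies differ by `o(t' - t)` in the support function, and the volume is Lipschitz
  -- there.
  have hd : HasDerivWithinAt (fun s => vol (u s) - k s) 0 (Ici t) t := by
    rw [hasDerivWithinAt_iff_isLittleO, Asymptotics.isLittleO_iff]
    intro ε hε
    obtain ⟨C, hC, hV⟩ := exists_abs_vol_sub_le n (supNorm (u t) + 1)
    have hnorm : ∀ᶠ t' in 𝓝[≥] t, supNorm (u t') < supNorm (u t) + 1 :=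
      ((continuous_supNorm.comp h.cont_u).continuousAt.continuousWithinAt).eventually_lt_const
        (lt_add_one _)
    have hη : 0 < ε / (C + 1) := by positivity
    have hsmall : ∀ᶠ t' in 𝓝[≥] t, ε / (C + 1) * (t' - t) < 1 :=
      (Continuous.continuousWithinAt (by fun_prop)).eventually_lt_const (by simp)
    filter_upwards [hnorm, hsmall, h.approx ht hη, self_mem_nhdsWithin] with t' h1 h2 h3 h4
    have h4' : 0 ≤ t' - t := sub_nonneg.2 h4
    have := hV _ (u t') h1.le _ ⟨mul_nonneg hη.le h4', h2.le⟩ h3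
    rw [hkt, sub_self, sub_zero, smul_zero, sub_zero, Real.norm_eq_abs, Real.norm_of_nonneg h4',
      abs_sub_comm]
    refine this.trans ?_
    rw [← mul_assoc]
    gcongr
    rw [mul_div_assoc', div_le_iff₀ (by positivity)]
    nlinarith
  have := hk.add hd
  rw [add_zero] at this
  exact this.congr_of_mem (fun s _ => (add_sub_cancel _ _).symm) self_mem_Ici

end VolumeEvolution

/-! ### Scalar comparison principles and the norm estimate -/

section Comparison

/-- Comparison of a subsolution and a supersolution of a locally Lipschitz autonomous equation,
for right derivatives. -/
theorem le_of_right_deriv {f x y x' y' : ℝ → ℝ} (hf : LocallyLipschitzOn (Ici 0) f)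
    (hx0 : ∀ t, 0 ≤ t → 0 ≤ x t) (hy0 : ∀ t, 0 ≤ t → 0 ≤ y t)
    (hxc : ContinuousOn x (Ici 0)) (hyc : ContinuousOn y (Ici 0))
    (hx : ∀ t, 0 ≤ t → HasDerivWithinAt x (x' t) (Ici t) t)
    (hy : ∀ t, 0 ≤ t → HasDerivWithinAt y (y' t) (Ici t) t)
    (hxf : ∀ t, 0 ≤ t → x' t ≤ f (x t)) (hyf : ∀ t, 0 ≤ t → f (y t) ≤ y' t) (h0 : x 0 ≤ y 0)
    {T : ℝ} (hT : 0 ≤ T) : x T ≤ y T := by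
  have hxc' : ContinuousOn x (Icc 0 T) := hxc.mono Icc_subset_Ici_self
  have hyc' : ContinuousOn y (Icc 0 T) := hyc.mono Icc_subset_Ici_self
  obtain ⟨M₁, hM₁⟩ := (isCompact_Icc.image_of_continuousOn hxc').bddAbove
  obtain ⟨M₂, hM₂⟩ := (isCompact_Icc.image_of_continuousOn hyc').bddAbove
  obtain ⟨K, hK⟩ := LocallyLipschitzOn.exists_lipschitzOnWith_of_compact
    (isCompact_Icc (a := (0 : ℝ)) (b := max M₁ M₂)) (hf.mono Icc_subset_Ici_self)
  have hmx : ∀ t ∈ Icc 0 T, x t ∈ Icc 0 (max M₁ M₂) := fun t ht =>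
    ⟨hx0 t ht.1, (hM₁ ⟨t, ht, rfl⟩).trans (le_max_left _ _)⟩
  have hmy : ∀ t ∈ Icc 0 T, y t ∈ Icc 0 (max M₁ M₂) := fun t ht =>
    ⟨hy0 t ht.1, (hM₂ ⟨t, ht, rfl⟩).trans (le_max_right _ _)⟩
  -- The barrier has rate `K + 1`, one more than the Lipschitz constant. Where `x - y` touches it,
  -- `x' - y' ≤ K (x - y) < (K + 1) (x - y)`, so it is never crossed. Then `ε → 0`.
  have key : ∀ ε > 0, x T - y T ≤ ε * Real.exp ((K + 1) * T) := by
    intro ε hε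
    refine image_le_of_deriv_right_lt_deriv_boundary (a := 0) (b := T)
      (f := fun t => x t - y t) (f' := fun t => x' t - y' t)
      (B := fun t => ε * Real.exp ((K + 1) * t))
      (B' := fun t => ε * (Real.exp ((K + 1) * t) * (K + 1))) (hxc'.sub hyc')
      (fun t ht => (hx t ht.1).sub (hy t ht.1)) ?_ ?_ ?_ (right_mem_Icc.2 hT)
    · simp; linarith
    · intro t
      have := ((hasDerivAt_id t).const_mul ((K : ℝ) + 1)).exp.const_mul ε
      simpa using this
    · intro t ht htB
      have ht' := Ico_subset_Icc_self ht
      have hpos : 0 < ε * Real.exp ((K + 1) * t) := by positivity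
      have h1 := hK.dist_le_mul _ (hmx t ht') _ (hmy t ht')
      rw [Real.dist_eq, Real.dist_eq, htB, abs_of_pos hpos] at h1
      have h2 := (le_abs_self _).trans h1
      have h3 := hxf t ht.1
      have h4 := hyf t ht.1
      nlinarith
  have hlim : Tendsto (fun ε : ℝ => ε * Real.exp ((K + 1) * T)) (𝓝[>] 0) (𝓝 0) :=
    (Continuous.tendsto' (f := fun ε : ℝ => ε * Real.exp ((K + 1) * T)) (by fun_prop) 0 0
      (zero_mul _)).mono_left nhdsWithin_le_nhds
  have := ge_of_tendsto hlim (eventually_mem_nhdsWithin.mono fun ε hε => key ε hε)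
  linarith

theorem IsScalarSolution.mono {f : ℝ → ℝ → ℝ} {I J : Set ℝ} {ω₀ : ℝ} {ω : ℝ → ℝ}
    (h : IsScalarSolution f I ω₀ ω) (hJ : J ⊆ I) : IsScalarSolution f J ω₀ ω :=
  ⟨h.1.mono hJ, fun t ht => h.2 t (hJ ht)⟩

/-- A solution of a linear equation stays strictly below a Caratheodory solution of a scalar
equation that dominates it. -/
theorem lt_of_isScalarSolution {f : ℝ → ℝ → ℝ} {ω₀ : ℝ} {ω w c β : ℝ → ℝ}
    (hω : IsScalarSolution f (Ici 0) ω₀ ω) (hc : Continuous c) (hβ : Continuous β)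
    (hw : ∀ t, HasDerivAt w (c t * w t + β t) t) (h0 : w 0 < ω₀)
    (hdom : ∀ t, 0 ≤ t → w t ≤ ω t → c t * ω t + β t ≤ f t (ω t)) {T : ℝ} (hT : 0 ≤ T) :
    w T < ω T := by
  by_contra! hcon
  have hwc : Continuous w := continuous_iff_continuousAt.2 fun t => (hw t).continuousAt
  set d : ℝ → ℝ := fun t => ω t - w t with hd_def
  have hdc : ContinuousOn d (Ici 0) := hω.1.sub hwc.continuousOn
  set S := {t | t ∈ Icc 0 T ∧ d t ≤ 0}
  have hScl : IsClosed S :=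
    (hdc.mono Icc_subset_Ici_self).preimage_isClosed_of_isClosed isClosed_Icc isClosed_Iic
  have hSne : S.Nonempty := ⟨T, right_mem_Icc.2 hT, sub_nonpos.2 hcon⟩
  have hSbd : BddBelow S := ⟨0, fun t ht => ht.1.1⟩
  obtain ⟨⟨hτ0, hτT⟩, hτd⟩ : sInf S ∈ S := hScl.csInf_mem hSne hSbd
  set τ := sInf S
  have hdpos : ∀ t, 0 ≤ t → t < τ → 0 < d t := fun t ht0 htτ => by
    by_contra! hle
    exact htτ.not_ge (csInf_le hSbd ⟨⟨ht0, htτ.le.trans hτT⟩, hle⟩)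
  have hω0 : ω 0 = ω₀ := by simpa using (hω.2 0 self_mem_Ici).2.2
  have hτpos : 0 < τ := hτ0.lt_of_ne fun h => by
    rw [← h, hd_def] at hτd
    simp only [hω0] at hτd
    linarith
  obtain ⟨m, hm⟩ := (isCompact_Icc.image (s := Icc 0 τ) hc.abs).bddAbove
  have hm' : ∀ t ∈ Icc 0 τ, |c t| ≤ m := fun t ht => hm ⟨t, ht, rfl⟩
  have hm0 : 0 ≤ m := (abs_nonneg _).trans (hm' 0 ⟨le_rfl, hτ0⟩)
  have hm1 : 0 < m + 1 := by positivity
  -- `ω` has only an integral equation, so the argument at the first contact time `τ` is integral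
  -- too. Let `d = ω - w` attain its maximum over `[s₀, τ]` at `s`. Since `d' ≥ c d ≥ -m d(s)` in
  -- integrated form, `d` loses at most `m / (m + 1) * d(s)` up to `τ`, which contradicts `d(τ) ≤
  -- 0`.
  set s₀ := max 0 (τ - 1 / (m + 1))
  have hs₀τ : s₀ < τ := max_lt hτpos (by have : 0 < 1 / (m + 1) := by positivity
                                         linarith)
  have hs₀0 : 0 ≤ s₀ := le_max_left _ _
  obtain ⟨s, hs, hmax⟩ := (isCompact_Icc (a := s₀) (b := τ)).exists_isMaxOn
    (nonempty_Icc.2 hs₀τ.le) (hdc.mono fun t ht => hs₀0.trans ht.1)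
  have hds : 0 < d s := (hdpos s₀ hs₀0 hs₀τ).trans_le (hmax (left_mem_Icc.2 hs₀τ.le))
  have hsτ : s < τ := hs.2.lt_of_ne fun h => by rw [h] at hds; linarith
  have hs0 : 0 ≤ s := hs₀0.trans hs.1
  have hrhs : Continuous fun t => c t * w t + β t := (hc.mul hwc).add hβ
  have hwint : w τ - w s = ∫ t in s..τ, (c t * w t + β t) :=
    (intervalIntegral.integral_eq_sub_of_hasDerivAt (fun t _ => hw t)
      (hrhs.intervalIntegrable _ _)).symm
  have hfi : ∀ t, 0 ≤ t → IntervalIntegrable (fun r => f r (ω r)) volume 0 t := fun t ht =>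
    (hω.2 t ht).2.1
  have hfi' : IntervalIntegrable (fun r => f r (ω r)) volume s τ :=
    (hfi s hs0).symm.trans (hfi τ hτ0)
  have hωint : ω τ - ω s = ∫ t in s..τ, f t (ω t) := by
    rw [(hω.2 τ hτ0).2.2, (hω.2 s hs0).2.2, ← intervalIntegral.integral_interval_sub_left
      (hfi τ hτ0) (hfi s hs0)]
    ring
  have hle : ∫ _ in s..τ, -(m * d s) ≤ ∫ t in s..τ, (f t (ω t) - (c t * w t + β t)) := by
    refine intervalIntegral.integral_mono_on_of_le_Ioo hsτ.le
      (continuous_const.intervalIntegrable _ _)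
      (hfi'.sub (hrhs.intervalIntegrable _ _)) fun t ht => ?_
    have ht0 : 0 ≤ t := hs0.trans ht.1.le
    have h1 := hdpos t ht0 ht.2
    have h2 := hdom t ht0 (sub_pos.1 h1).le
    have h3 : d t ≤ d s := hmax ⟨hs.1.trans ht.1.le, ht.2.le⟩
    have h4 := (abs_le.1 (hm' t ⟨ht0, ht.2.le⟩)).1
    have h5 : -m * d t ≤ c t * d t := mul_le_mul_of_nonneg_right h4 h1.le
    have h6 : m * d t ≤ m * d s := mul_le_mul_of_nonneg_left h3 hm0
    have h7 : c t * d t = c t * ω t - c t * w t := mul_sub _ _ _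
    linarith
  rw [intervalIntegral.integral_sub hfi' (hrhs.intervalIntegrable _ _), ← hωint, ← hwint,
    intervalIntegral.integral_const, smul_eq_mul] at hle
  have hτs : τ - s ≤ 1 / (m + 1) := by linarith [le_max_right 0 (τ - 1 / (m + 1)), hs.1]
  have h8 : (τ - s) * (m * d s) ≤ 1 / (m + 1) * (m * d s) := by gcongr
  have h9 : 1 / (m + 1) * (m * d s) < d s := by
    rw [one_div, inv_mul_lt_iff₀ hm1]
    linarith
  have h10 : d τ - d s = (ω τ - ω s) - (w τ - w s) := by simp only [hd_def]; ring
  linarith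

/-- The solution of `w' = α a(t) w + β(t)`, `w(0) = v`. -/
def linearSolution (α : ℝ) (a β : ℝ → ℝ) (v t : ℝ) : ℝ :=
  Real.exp (α * ∫ s in (0 : ℝ)..t, a s) *
    (v + ∫ s in (0 : ℝ)..t, Real.exp (-(α * ∫ τ in (0 : ℝ)..s, a τ)) * β s)

theorem hasDerivAt_linearSolution {α : ℝ} {a β : ℝ → ℝ} (ha : Continuous a) (hβ : Continuous β)
    (v t : ℝ) : HasDerivAt (linearSolution α a β v)
      (α * a t * linearSolution α a β v t + β t) t := by
  have hI : ∀ t, HasDerivAt (fun t => ∫ s in (0 : ℝ)..t, a s) (a t) t := fun t =>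
    intervalIntegral.integral_hasDerivAt_right (ha.intervalIntegrable _ _)
      (ha.stronglyMeasurableAtFilter _ _) ha.continuousAt
  have hIc : Continuous fun t => ∫ s in (0 : ℝ)..t, a s :=
    continuous_iff_continuousAt.2 fun t => (hI t).continuousAt
  have hg : Continuous fun s => Real.exp (-(α * ∫ τ in (0 : ℝ)..s, a τ)) * β s := by fun_prop
  have hJ := intervalIntegral.integral_hasDerivAt_right (hg.intervalIntegrable 0 t)
    (hg.stronglyMeasurableAtFilter _ _) hg.continuousAt
  have := (((hI t).const_mul α).exp).mul (hJ.const_add v)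
  refine this.congr_deriv ?_
  rw [linearSolution, Real.exp_neg]
  have := (Real.exp_pos (α * ∫ s in (0 : ℝ)..t, a s)).ne'
  field_simp

theorem linearSolution_zero (α : ℝ) (a β : ℝ → ℝ) (v : ℝ) : linearSolution α a β v 0 = v := by
  simp [linearSolution]

theorem linearSolution_eq (α : ℝ) {a : ℝ → ℝ} (ha : Continuous a) (β : ℝ → ℝ) (v t : ℝ) :
    linearSolution α a β v t = Real.exp (α * ∫ s in (0 : ℝ)..t, a s) * v +
      ∫ s in (0 : ℝ)..t, Real.exp (α * ∫ τ in s..t, a τ) * β s := by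
  rw [linearSolution, mul_add, ← intervalIntegral.integral_const_mul (Real.exp _)]
  congr 1
  refine intervalIntegral.integral_congr fun s _ => ?_
  rw [← mul_assoc, ← Real.exp_add, ← intervalIntegral.integral_interval_sub_left (f := a)
    (μ := volume) (ha.intervalIntegrable 0 t) (ha.intervalIntegrable 0 s)]
  congr 2
  ring

variable {A : E n →L[ℝ] E n} {a : ℝ → ℝ} {b : ℝ → Conv n} {u₀ : Conv n} {u : ℝ → Conv n}

/-- Norms are taken in the integral equation; `a ≥ 0` keeps the exponents in the range where the
bound on `e^{At}` is assumed. The result is `N` times the variation-of-constants formula of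
`linearSolution_eq`. -/
theorem IsMildSolution.supNorm_le (h : IsMildSolution A a b u₀ u) {N α : ℝ}
    (hN : ∀ t : ℝ, 0 ≤ t → ‖NormedSpace.exp (t • A)‖ ≤ N * Real.exp (α * t))
    (ha0 : ∀ t, 0 ≤ a t) {t : ℝ} (ht : 0 ≤ t) :
    supNorm (u t) ≤ N * linearSolution α a (fun s => supNorm (b s)) (supNorm u₀) t := by
  set B := ContinuousLinearMap.adjoint A
  have hint : ∀ s t : ℝ, s ≤ t → 0 ≤ ∫ τ in s..t, a τ := fun s t hst =>
    intervalIntegral.integral_nonneg hst fun τ _ => ha0 τ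
  have hE : ∀ τ : ℝ, 0 ≤ τ → ∀ w : Conv n, ∀ p : E n, ‖p‖ = 1 →
      |supportFun w (NormedSpace.exp (τ • B) p)| ≤ N * (Real.exp (α * τ) * supNorm w) := by
    intro τ hτ w p hp
    have h1 := ContinuousLinearMap.le_opNorm (NormedSpace.exp (τ • B)) p
    rw [hp, mul_one, exp_smul_adjoint, LinearIsometryEquiv.norm_map] at h1
    calc |supportFun w (NormedSpace.exp (τ • B) p)|
        ≤ supNorm w * ‖NormedSpace.exp (τ • B) p‖ := abs_supportFun_le _ _
      _ ≤ supNorm w * (N * Real.exp (α * τ)) := by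
          refine mul_le_mul_of_nonneg_left ?_ (supNorm_nonneg w)
          rw [exp_smul_adjoint]
          exact h1.trans (hN τ hτ)
      _ = _ := by ring
  have hbound : ∀ p : E n, ‖p‖ = 1 → |supportFun (u t) p| ≤
      N * linearSolution α a (fun s => supNorm (b s)) (supNorm u₀) t := by
    intro p hp
    rw [h.eq t ht p, linearSolution_eq α h.cont_a, mul_add, ← intervalIntegral.integral_const_mul N]
    refine (abs_add_le _ _).trans (add_le_add (hE _ (hint _ _ ht) _ p hp) ?_)
    have hcont : Continuous fun s =>
        N * (Real.exp (α * ∫ τ in s..t, a τ) * supNorm (b s)) := by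
      have h1 : Continuous fun s => ∫ τ in s..t, a τ :=
        (continuous_integral₂ h.cont_a).comp (continuous_id.prodMk continuous_const)
      have h2 := continuous_supNorm.comp h.cont_b
      simp only [Function.comp_def] at h2
      fun_prop
    refine intervalIntegral.norm_integral_le_of_norm_le (μ := volume)
      (f := fun s => supportFun (b s) (NormedSpace.exp ((∫ τ in s..t, a τ) • B) p)) ht (.of_forall fun s hs => ?_)
      (hcont.intervalIntegrable _ _)
    exact hE _ (hint _ _ hs.2) _ p hp
  -- Nonnegativity of the bound is read off at a unit vector; without unit vectors all norms vanish.
  by_cases hne : ∃ p : E n, ‖p‖ = 1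
  · obtain ⟨p, hp⟩ := hne
    exact ConvSemiflow.supNorm_le ((abs_nonneg _).trans (hbound p hp)) hbound
  · push Not at hne
    have hz : ∀ w : Conv n, supNorm w = 0 := fun w =>
      le_antisymm (ConvSemiflow.supNorm_le le_rfl fun p hp => absurd hp (hne p)) (supNorm_nonneg w)
    simp [hz, linearSolution]

end Comparison

/-! ### Enclosure of orbits and transfer of stability -/

section Stability

/-- Precomposition with `max s 0` freezes the orbit at its initial value for negative times, so the
coefficients are continuous on the whole line. -/
theorem Params.IsSolution.isMildSolution {P : Params n} {u₀ : Conv n} {u : ℝ → Conv n}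
    (h : P.IsSolution u₀ u) : IsMildSolution P.A (fun s => P.φ (vol (u (max s 0))))
      (fun s => P.F (vol (u (max s 0))) (u (max s 0))) u₀ (fun s => u (max s 0)) := by
  have hu : Continuous fun s : ℝ => u (max s 0) :=
    h.1.comp_continuous (by fun_prop) fun s => le_max_right s 0
  have hv : Continuous fun s : ℝ => vol (u (max s 0)) := continuous_vol.comp hu
  refine ⟨P.φ_lipschitz.continuousOn.comp_continuous hv fun s => vol_nonneg _,
    P.F_lipschitz.continuousOn.comp_continuous (hv.prodMk hu)
      fun s => ⟨vol_nonneg _, mem_univ _⟩, hu, fun t ht p => ?_⟩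
  have hφ : ∀ s t' : ℝ, 0 ≤ s → 0 ≤ t' → (∫ τ in s..t', P.φ (vol (u (max τ 0)))) =
      ∫ τ in s..t', P.φ (vol (u τ)) := fun s t' hs ht' =>
    intervalIntegral.integral_congr fun τ hτ => by
      have : 0 ≤ τ := (le_min hs ht').trans hτ.1
      simp only [max_eq_left this]
  rw [max_eq_left ht, h.2 t ht p, Params.expOp, hφ 0 t le_rfl ht]
  congr 1
  refine intervalIntegral.integral_congr fun s hs => ?_
  rw [uIcc_of_le ht] at hs
  simp only [Params.expOp, max_eq_left hs.1, hφ s t hs.1 ht]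

theorem locallyLipschitzOn_volumeRhs {φ g : ℝ → ℝ} (hφ : LocallyLipschitzOn (Ici 0) φ)
    (hg : LocallyLipschitzOn (Ici 0) g) (k : ℝ) :
    LocallyLipschitzOn (Ici 0) fun z => k * φ z * z + g z := by
  intro z hz
  obtain ⟨K₁, s, hs, h₁⟩ := hφ hz
  obtain ⟨K₂, t, ht, h₂⟩ := hg hz
  have hb : ∀ᶠ y in 𝓝[Ici 0] z, |φ y| < |φ z| + 1 :=
    (hφ.continuousOn z hz).abs.eventually_lt_const (lt_add_one _)
  have hc : ∀ᶠ y in 𝓝[Ici 0] z, |y| < |z| + 1 :=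
    continuous_abs.continuousWithinAt.eventually_lt_const (lt_add_one _)
  refine ⟨(|k| * (K₁ * (|z| + 1) + (|φ z| + 1)) + K₂).toNNReal, _,
    inter_mem (inter_mem hs ht) (hb.and hc), LipschitzOnWith.of_dist_le_mul fun x hx y hy => ?_⟩
  have e₁ := h₁.dist_le_mul x hx.1.1 y hy.1.1
  have e₂ := h₂.dist_le_mul x hx.1.2 y hy.1.2
  have e₃ : |φ y| < |φ z| + 1 := hy.2.1
  have e₄ : |x| < |z| + 1 := hx.2.2
  simp only [Real.dist_eq] at e₁ e₂ ⊢
  rw [Real.coe_toNNReal _ (by positivity)]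
  have e₅ : k * φ x * x + g x - (k * φ y * y + g y) =
      k * ((φ x - φ y) * x + φ y * (x - y)) + (g x - g y) := by ring
  rw [e₅]
  calc _ ≤ |k * ((φ x - φ y) * x + φ y * (x - y))| + |g x - g y| := abs_add_le _ _
    _ ≤ |k| * (|φ x - φ y| * |x| + |φ y| * |x - y|) + |g x - g y| := by
        rw [abs_mul]
        gcongr
        refine (abs_add_le _ _).trans ?_
        rw [abs_mul, abs_mul]
    _ ≤ |k| * (K₁ * |x - y| * (|z| + 1) + (|φ z| + 1) * |x - y|) + K₂ * |x - y| := by gcongr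
    _ = _ := by ring

variable {P : Params n} {G : Set (Conv n)} {𝔉 : ℝ → Conv n → Conv n} {r N α : ℝ}
  {gLow gUp : ℝ → ℝ} {χ ζ : ℝ → ℝ → ℝ} {Fp : ℝ → ℝ → ℝ → ℝ} {Lp Lm : ℝ → ℝ} {Fh : ℝ → ℝ → ℝ}

/-- The volume of a solution is enclosed by the two scalar comparison solutions. -/
theorem vol_mem_Icc (hn : n ≠ 0) {B : Set (Conv n)}
    (hcond : ComparisonConditions P B N α gLow gUp χ ζ Fp) {u₀ : Conv n} (hu₀ : u₀ ∈ B)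
    {u : ℝ → Conv n} (hu : P.IsSolution u₀ u) {t : ℝ} (ht : 0 ≤ t) :
    vol (u t) ∈ Icc (χ (vol u₀) t) (ζ (vol u₀) t) := by
  have hm := hu.isMildSolution
  obtain ⟨⟨hζ0, hζ⟩, -⟩ := hcond.zeta_maximal u₀ hu₀
  obtain ⟨⟨hχ0, hχ⟩, -⟩ := hcond.chi_minimal u₀ hu₀
  set v : ℝ → ℝ := fun s => vol (u (max s 0))
  have hv0 : v 0 = vol u₀ := by
    have h0 : supportFun (u 0) = supportFun u₀ := by
      funext p
      have := hm.eq 0 le_rfl p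
      simpa [exp_zero_smul] using this
    have : u 0 = u₀ := ConvexBody.ext (Subset.antisymm
      (subset_of_supportFun_le fun p => (congrFun h0 p).le)
      (subset_of_supportFun_le fun p => (congrFun h0 p).ge))
    simp [v, this]
  have hvc : ContinuousOn v (Ici 0) := (continuous_vol.comp hm.cont_u).continuousOn
  have hvd : ∀ s, 0 ≤ s → HasDerivWithinAt v (P.tr * P.φ (v s) * v s +
      n * mixedVol₁ (u (max s 0)) (P.F (v s) (u (max s 0)))) (Ici s) s :=
    fun s hs => hm.hasDerivWithinAt_vol hn hs
  have hsub : ∀ s : ℝ, 0 ≤ s → Ici s ⊆ Ici (0 : ℝ) := fun s hs => Ici_subset_Ici.2 hs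
  have hvt : v t = vol (u t) := by simp only [v, max_eq_left ht]
  rw [← hvt]
  constructor
  · refine le_of_right_deriv (locallyLipschitzOn_volumeRhs P.φ_lipschitz hcond.gLow_lipschitz P.tr)
      (fun s hs => (hχ s hs).1) (fun s _ => vol_nonneg _)
      (fun s hs => (hχ s hs).2.continuousWithinAt) hvc
      (fun s hs => (hχ s hs).2.mono (hsub s hs)) hvd (fun s _ => le_rfl) (fun s _ => ?_)
      (hχ0.trans hv0.symm).le ht
    exact add_le_add le_rfl (hcond.gLow_le _)
  · refine le_of_right_deriv (locallyLipschitzOn_volumeRhs P.φ_lipschitz hcond.gUp_lipschitz P.tr)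
      (fun s _ => vol_nonneg _) (fun s hs => (hζ s hs).1) hvc
      (fun s hs => (hζ s hs).2.continuousWithinAt) hvd
      (fun s hs => (hζ s hs).2.mono (hsub s hs)) (fun s _ => ?_) (fun s _ => le_rfl)
      (hv0.trans hζ0.symm).le ht
    exact add_le_add le_rfl (hcond.le_gUp _)

/-- Every solution of the scalar comparison equation that starts above `‖u₀‖` bounds the orbit
of `u₀`. -/
theorem supNorm_lt_of_isScalarSolution (hn : n ≠ 0)
    (hcond : ComparisonConditions P (ball G r) N α gLow gUp χ ζ Fp)
    (hLp : ∀ t : ℝ, 0 ≤ t → IsLUB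
      ((fun u₀ => lambdaPlus P.φ χ ζ t (vol u₀)) '' ball G r) (Lp t))
    (hLm : ∀ t : ℝ, 0 ≤ t → IsGLB
      ((fun u₀ => lambdaMinus P.φ χ ζ t (vol u₀)) '' ball G r) (Lm t))
    (hFh : ∀ t ω : ℝ, 0 ≤ t → 0 ≤ ω → IsLUB ((fun u₀ => Fp t ω (vol u₀)) '' ball G r) (Fh t ω))
    {u₀ : Conv n} (hu₀ : u₀ ∈ ball G r) {u : ℝ → Conv n} (hu : P.IsSolution u₀ u)
    {ω₀ : ℝ} (hω₀ : supNorm u₀ < ω₀) {ω : ℝ → ℝ}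
    (hω : IsScalarSolution (comparisonRhs N α Lp Lm Fh) (Ici 0) ω₀ ω) {t : ℝ} (ht : 0 ≤ t) :
    supNorm (u t) < N * ω t := by
  have hm := hu.isMildSolution
  set a : ℝ → ℝ := fun s => P.φ (vol (u (max s 0))) with ha_def
  set b : ℝ → Conv n := fun s => P.F (vol (u (max s 0))) (u (max s 0)) with hb_def
  set w := linearSolution α a (fun s => supNorm (b s)) (supNorm u₀)
  have hβ : Continuous fun s => supNorm (b s) := continuous_supNorm.comp hm.cont_b
  have ha0 : ∀ s, 0 ≤ a s := fun s => P.φ_nonneg _ (vol_nonneg _)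
  have hbound : ∀ s, 0 ≤ s → supNorm (u s) ≤ N * w s := fun s hs => by
    simpa only [max_eq_left hs] using hm.supNorm_le hcond.exp_bound ha0 hs
  have hlt : w t < ω t := by
    refine lt_of_isScalarSolution hω (c := fun s => α * a s) (hm.cont_a.const_mul α) hβ
      (fun s => hasDerivAt_linearSolution hm.cont_a hβ _ s) ?_ (fun s hs hws => ?_) ht
    · rwa [linearSolution_zero]
    · have hV := vol_mem_Icc hn hcond hu₀ hu hs
      have hω0 : 0 ≤ ω s := (hω.2 s hs).1
      have hNω : 0 ≤ N * ω s := mul_nonneg hcond.N_pos.le hω0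
      have hχ0 : 0 ≤ χ (vol u₀) s := ((hcond.chi_minimal u₀ hu₀).1.2 s hs).1
      have hcomp : IsCompact (P.φ '' Icc (χ (vol u₀) s) (ζ (vol u₀) s)) :=
        isCompact_Icc.image_of_continuousOn
          (P.φ_lipschitz.continuousOn.mono fun z hz => hχ0.trans hz.1)
      have ha : a s = P.φ (vol (u s)) := by simp only [ha_def, max_eq_left hs]
      have hb : b s = P.F (vol (u s)) (u s) := by simp only [hb_def, max_eq_left hs]
      -- Multiplication by `α` reverses the order when `α ≤ 0`, so the lower bound of `φ` is then
      -- the relevant one.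
      have hlin : α * a s ≤ α * (if 0 < α then Lp s else Lm s) := by
        rw [ha]
        split_ifs with hα
        · refine mul_le_mul_of_nonneg_left ?_ hα.le
          exact (le_csSup hcomp.bddAbove ⟨_, hV, rfl⟩).trans ((hLp s hs).1 ⟨u₀, hu₀, rfl⟩)
        · refine mul_le_mul_of_nonpos_left ?_ (not_lt.1 hα)
          exact ((hLm s hs).1 ⟨u₀, hu₀, rfl⟩).trans (csInf_le hcomp.bddBelow ⟨_, hV, rfl⟩)
      have hF : supNorm (b s) ≤ Fh s (N * ω s) := by
        rw [hb]
        -- The assumption `w ≤ ω` enters here: `‖u(s)‖ ≤ N w(s) ≤ N ω(s)`, and `F⁺` is nondecreasing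
        -- in its second argument.
        calc _ ≤ Fp s (supNorm (u s)) (vol u₀) := hcond.F_bound u₀ hu₀ s hs (u s) _ hV
          _ ≤ Fp s (N * ω s) (vol u₀) :=
            hcond.Fp_monotone u₀ hu₀ s hs (supNorm_nonneg _) hNω
              ((hbound s hs).trans (mul_le_mul_of_nonneg_left hws hcond.N_pos.le))
          _ ≤ _ := (hFh s _ hs hNω).1 ⟨u₀, hu₀, rfl⟩
      exact add_le_add (mul_le_mul_of_nonneg_right hlin hω0) hF
  exact (hbound t ht).trans_lt (mul_lt_mul_of_pos_left hlt hcond.N_pos)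

theorem supNorm_eq_zero_of_dim_zero (u : Conv 0) : supNorm u = 0 :=
  le_antisymm (supNorm_le le_rfl fun p hp => by
    rw [Subsingleton.elim p 0, norm_zero] at hp
    exact absurd hp zero_ne_one) (supNorm_nonneg u)

theorem semiflowStable_of_zeroStable (hr : 0 < r) (hN : 0 < N) {f : ℝ → ℝ → ℝ}
    (hdom : ∀ u₀ ∈ ball G r, ∀ ω₀, supNorm u₀ < ω₀ → ∀ ω, IsScalarSolution f (Ici 0) ω₀ ω →
      ∀ t, 0 ≤ t → supNorm (𝔉 t u₀) < N * ω t) (hf : ZeroStable f) :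
    SemiflowStable G 𝔉 supNorm supNorm := by
  intro ε hε
  obtain ⟨δ, hδ, h⟩ := hf.2 (ε / N) (div_pos hε hN)
  -- The radius `r` keeps `u₀` in the ball where the comparison conditions hold; `δ` leaves room for
  -- `ω₀` strictly above `‖u₀‖`.
  refine ⟨min δ r, lt_min hδ hr, fun u₀ hu₀ hlt t ht => ?_⟩
  obtain ⟨ω₀, h₁, h₂⟩ := exists_between (hlt.trans_le (min_le_left δ r))
  obtain ⟨⟨ω, hω⟩, hall⟩ := h ω₀ ((supNorm_nonneg u₀).trans h₁.le) h₂
  have h₃ := hdom u₀ ⟨hu₀, (hlt.trans_le (min_le_right δ r)).le⟩ ω₀ h₁ ω hω t ht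
  have h₄ := hall (t + 1) (by linarith) ω (hω.mono Ico_subset_Ici_self) t ⟨ht, lt_add_one t⟩
  rw [lt_div_iff₀ hN] at h₄
  linarith

theorem semiflowAsympStable_of_zeroAsympStable (hr : 0 < r) (hN : 0 < N) {f : ℝ → ℝ → ℝ}
    (hdom : ∀ u₀ ∈ ball G r, ∀ ω₀, supNorm u₀ < ω₀ → ∀ ω, IsScalarSolution f (Ici 0) ω₀ ω →
      ∀ t, 0 ≤ t → supNorm (𝔉 t u₀) < N * ω t) (hf : ZeroAsympStable f) :
    SemiflowAsympStable G 𝔉 supNorm supNorm := by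
  refine ⟨semiflowStable_of_zeroStable hr hN hdom hf.1, ?_⟩
  obtain ⟨δ, hδ, h⟩ := hf.1.2 1 one_pos
  obtain ⟨ρ, hρ, hlim⟩ := hf.2
  refine ⟨min (min δ ρ) r, lt_min (lt_min hδ hρ) hr, fun u₀ hu₀ hlt => ?_⟩
  obtain ⟨ω₀, h₁, h₂⟩ := exists_between (hlt.trans_le (min_le_left _ r))
  have h₀ := (supNorm_nonneg u₀).trans h₁.le
  obtain ⟨⟨ω, hω⟩, -⟩ := h ω₀ h₀ (h₂.trans_le (min_le_left δ ρ))
  have h₃ := hlim ω₀ h₀ (h₂.trans_le (min_le_right δ ρ)) ω hω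
  refine squeeze_zero' (.of_forall fun t => supNorm_nonneg _) ?_
    (by simpa using h₃.const_mul N)
  filter_upwards [eventually_ge_atTop 0] with t ht
  exact (hdom u₀ ⟨hu₀, (hlt.trans_le (min_le_right _ r)).le⟩ ω₀ h₁ ω hω t ht).le

end Stability

end ConvSemiflow

end

theorem theorem4p6 {n : ℕ} (P : ConvSemiflow.Params n)
    (G : Set (ConvSemiflow.Conv n)) (hG : IsClosed G) (hG0 : (0 : ConvSemiflow.Conv n) ∈ G)
    (𝔉 : ℝ → ConvSemiflow.Conv n → ConvSemiflow.Conv n)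
    (h𝔉 : P.IsGlobalSemiflowOn G 𝔉) (hfix : ∀ t : ℝ, 0 ≤ t → 𝔉 t 0 = 0)
    (r : ℝ) (hr : 0 < r) (N α : ℝ) (gLow gUp : ℝ → ℝ)
    (χ ζ : ℝ → ℝ → ℝ) (Fp : ℝ → ℝ → ℝ → ℝ)
    (hcond : ConvSemiflow.ComparisonConditions P (ConvSemiflow.ball G r) N α gLow gUp χ ζ Fp)
    (Lp Lm : ℝ → ℝ) (Fh : ℝ → ℝ → ℝ)
    (hLp : ∀ t : ℝ, 0 ≤ t → IsLUB
      ((fun u₀ => ConvSemiflow.lambdaPlus P.φ χ ζ t (ConvSemiflow.vol u₀)) ''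
        ConvSemiflow.ball G r) (Lp t))
    (hLm : ∀ t : ℝ, 0 ≤ t → IsGLB
      ((fun u₀ => ConvSemiflow.lambdaMinus P.φ χ ζ t (ConvSemiflow.vol u₀)) ''
        ConvSemiflow.ball G r) (Lm t))
    (hFh : ∀ t ω : ℝ, 0 ≤ t → 0 ≤ ω → IsLUB
      ((fun u₀ => Fp t ω (ConvSemiflow.vol u₀)) '' ConvSemiflow.ball G r) (Fh t ω)) :
    (ConvSemiflow.ZeroStable (ConvSemiflow.comparisonRhs N α Lp Lm Fh) →
      ConvSemiflow.SemiflowStable G 𝔉 ConvSemiflow.supNorm ConvSemiflow.supNorm) ∧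
    (ConvSemiflow.ZeroAsympStable (ConvSemiflow.comparisonRhs N α Lp Lm Fh) →
      ConvSemiflow.SemiflowAsympStable G 𝔉 ConvSemiflow.supNorm ConvSemiflow.supNorm) := by
  -- In dimension zero the unit sphere is empty and the norm vanishes identically; polar coordinates
  -- and the factor `1 / n` need `n ≠ 0`.
  rcases eq_or_ne n 0 with rfl | hn
  · have hz : ConvSemiflow.SemiflowStable G 𝔉 ConvSemiflow.supNorm ConvSemiflow.supNorm :=
      fun ε hε => ⟨1, one_pos, fun u₀ _ _ t _ => by
        rwa [ConvSemiflow.supNorm_eq_zero_of_dim_zero]⟩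
    refine ⟨fun _ => hz, fun _ => ⟨hz, 1, one_pos, fun u₀ _ _ => ?_⟩⟩
    simp only [ConvSemiflow.supNorm_eq_zero_of_dim_zero]
    exact tendsto_const_nhds
  · have hdom : ∀ u₀ ∈ ConvSemiflow.ball G r, ∀ ω₀, ConvSemiflow.supNorm u₀ < ω₀ → ∀ ω,
        ConvSemiflow.IsScalarSolution (ConvSemiflow.comparisonRhs N α Lp Lm Fh) (Ici 0) ω₀ ω →
          ∀ t, 0 ≤ t → ConvSemiflow.supNorm (𝔉 t u₀) < N * ω t :=
      fun u₀ hu₀ ω₀ hω₀ ω hω t ht => ConvSemiflow.supNorm_lt_of_isScalarSolution hn hcond hLp hLm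
        hFh hu₀ (h𝔉 u₀ hu₀.1).2 hω₀ hω ht
    exact ⟨ConvSemiflow.semiflowStable_of_zeroStable hr hcond.N_pos hdom,
      ConvSemiflow.semiflowAsympStable_of_zeroAsympStable hr hcond.N_pos hdom⟩
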